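/- All rings are associative with identity and modules are unitary; "module" means left module, not necessarily finitely generated. For a ring $R$, a complete $R$-projective resolution is an exact complex $P^\bullet=(\cdots\to P^{-1}\to P^0\xrightarrow{d^0}P^1\to\cdots)$ of projective $R$-modules such that $\operatorname{Hom}_R(P^\bullet,Q)$ is exact for every projective $R$-module $Q$. An $R$-module is Gorenstein projective, written $G\in\operatorname{GProj}R$, if $G\cong\operatorname{Im}(d^0)$ for some complete $R$-projective resolution. For an $R$-module $V$, $\operatorname{Add}V$ is the class of $R$-modules isomorphic to direct summands of direct sums of copies of $V$. Let $A$ and $B$ be rings, ${}_AM_B$ and ${}_BN_A$ bimodules, and let $\Lambda=\Lambda_{(0,0)}=\begin{bmatrix}A&M\\N&B\end{bmatrix}$ be the Morita context ring with zero bimodule homomorphisms $M\otimes_BN\to A$ and $N\otimes_AM\to B$. A $\Lambda$-module is identified with a quadruple $(X,Y,f,g)$, where $X$ is an $A$-module, $Y$ is a $B$-module, and $f:N\otimes_AX\to Y$ ($B$-linear) and $g:M\otimes_BY\to X$ ($A$-linear) satisfy $g\circ(1_M\otimes f)=0$ and $f\circ(1_N\otimes g)=0$; the corresponding $\Lambda$-module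 is $X\oplus Y$ with $\begin{pmatrix}a&m\\n&b\end{pmatrix}\begin{pmatrix}x\\y\end{pmatrix}=\begin{pmatrix}ax+g(m\otimes y)\\f(n\otimes x)+by\end{pmatrix}$. Write $(A,B,0,0)$ for $A\times B$ regarded as a left and as a right $\Lambda$-module through the ring homomorphism $\Lambda\to A\times B$, $\begin{pmatrix}a&m\\n&b\end{pmatrix}\mapsto(a,b)$. Assume: 1. for every complete $A$-projective resolution $P^\bullet$ and every complete $B$-projective resolution $\widetilde P^\bullet$, the complexes $N\otimes_AP^\bullet$, $M\otimes_B\widetilde P^\bullet$, $\operatorname{Hom}_A(P^\bullet,W)$ for all $W\in\operatorname{Add}({}_AM)$, and $\operatorname{Hom}_B(\widetilde P^\bullet,W')$ for all $W'\in\operatorname{Add}({}_BN)$ are exact; 2. for every complete $\Lambda$-projective resolution $Q^\bullet$, the complexes $(A,B,0,0)\otimes_\Lambda Q^\bullet$ and $\operatorname{Hom}_\Lambda(Q^\bullet,W)$ for all $W\in\operatorname{Add}(A,B,0,0)$ are exact. Then for every $\Lambda$-module $(X,Y,f,g)$ the following are equivalent: (1) $(X,Y,f,g)\in\operatorname{GProj}\Lambda$;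 (2) $\operatorname{Coker}f\in\operatorname{GProj}B$, $\operatorname{Coker}g\in\operatorname{GProj}A$, and $g$ and $f$ induce isomorphisms $M\otimes_B\operatorname{Coker}f\cong\operatorname{Im}g$, $m\otimes\overline y\mapsto g(m\otimes y)$, and $N\otimes_A\operatorname{Coker}g\cong\operatorname{Im}f$, $n\otimes\overline x\mapsto f(n\otimes x)$; (3) $\operatorname{Coker}f\in\operatorname{GProj}B$, $\operatorname{Coker}g\in\operatorname{GProj}A$, and the sequences $$M\otimes_BN\otimes_AX\xrightarrow{1_M\otimes f}M\otimes_BY\xrightarrow{g}X,\qquad N\otimes_AM\otimes_BY\xrightarrow{1_N\otimes g}N\otimes_AX\xrightarrow{f}Y$$ are exact. -/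

import Mathlib

universe u

open scoped TensorProduct
open MulOpposite

namespace MoritaGP

/-! ### Tensor products over a not necessarily commutative ring

A right `R`-module is a `Module Rᵐᵒᵖ M`, with `m r` written `op r • m`. An `S`-`R`-bimodule is a
left `S`-module that is also a right `R`-module, with commuting actions. -/

/-- The subgroup of `M ⊗_ℤ Y` generated by all `(m r) ⊗ y - m ⊗ (r y)`. -/
def balancedRel (R M Y : Type u) [Ring R] [AddCommGroup M] [Module Rᵐᵒᵖ M]
    [AddCommGroup Y] [Module R Y] : AddSubgroup (M ⊗[ℤ] Y) :=
  AddSubgroup.closure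
    {z | ∃ (m : M) (r : R) (y : Y), z = (op r • m) ⊗ₜ[ℤ] y - m ⊗ₜ[ℤ] (r • y)}

/-- The tensor product `M ⊗_R Y` of a right `R`-module `M` and a left `R`-module `Y`. -/
def Tens (R M Y : Type u) [Ring R] [AddCommGroup M] [Module Rᵐᵒᵖ M]
    [AddCommGroup Y] [Module R Y] : Type u :=
  (M ⊗[ℤ] Y) ⧸ balancedRel R M Y

noncomputable section TensorBasics

variable (R : Type u) {S M Y Z P : Type u} [Ring R] [Ring S] [AddCommGroup M] [Module Rᵐᵒᵖ M]
  [AddCommGroup Y] [Module R Y] [AddCommGroup Z] [Module R Z] [AddCommGroup P]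

instance : AddCommGroup (Tens R M Y) :=
  inferInstanceAs (AddCommGroup ((M ⊗[ℤ] Y) ⧸ balancedRel R M Y))

/-- The elementary tensor `m ⊗ y` in `M ⊗_R Y`. -/
def tmul (m : M) (y : Y) : Tens R M Y :=
  QuotientAddGroup.mk' (balancedRel R M Y) (m ⊗ₜ[ℤ] y)

theorem tmul_add (m : M) (y y' : Y) : tmul R m (y + y') = tmul R m y + tmul R m y' := by
  simp only [tmul, TensorProduct.tmul_add, map_add]
  rfl

theorem add_tmul (m m' : M) (y : Y) : tmul R (m + m') y = tmul R m y + tmul R m' y := by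
  simp only [tmul, TensorProduct.add_tmul, map_add]
  rfl

theorem tmul_zero (m : M) : tmul R m (0 : Y) = 0 := by
  have h := tmul_add R m (0 : Y) 0
  rw [add_zero] at h
  exact left_eq_add.mp h

theorem zero_tmul (y : Y) : tmul R (0 : M) y = 0 := by
  have h := add_tmul R (0 : M) 0 y
  rw [add_zero] at h
  exact left_eq_add.mp h

theorem smul_tmul (m : M) (r : R) (y : Y) : tmul R (op r • m) y = tmul R m (r • y) := by
  have h : (op r • m) ⊗ₜ[ℤ] y - m ⊗ₜ[ℤ] (r • y) ∈ balancedRel R M Y :=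
    AddSubgroup.subset_closure ⟨m, r, y, rfl⟩
  rw [← QuotientAddGroup.eq_zero_iff] at h
  exact sub_eq_zero.mp h

theorem tens_induction {p : Tens R M Y → Prop} (h0 : p 0) (ht : ∀ m y, p (tmul R m y))
    (ha : ∀ a b, p a → p b → p (a + b)) (z : Tens R M Y) : p z := by
  obtain ⟨w, rfl⟩ := QuotientAddGroup.mk'_surjective (balancedRel R M Y) z
  induction w using TensorProduct.induction_on with
  | zero => exact h0
  | tmul m y => exact ht m y
  | add a b iha ihb =>
    rw [map_add]
    exact ha _ _ iha ihb

theorem tens_hom_ext {φ ψ : Tens R M Y →+ P} (h : ∀ m y, φ (tmul R m y) = ψ (tmul R m y)) :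
    φ = ψ := by
  ext z
  refine tens_induction R (p := fun z => φ z = ψ z) ?_ h ?_ z
  · rw [map_zero, map_zero]
  · intro a b ha hb
    rw [map_add, map_add, ha, hb]

/-- The additive map out of `M ⊗_R Y` given by a biadditive `R`-balanced map. -/
def tensLift (F : M →+ Y →+ P) (hF : ∀ (m : M) (r : R) (y : Y), F (op r • m) y = F m (r • y)) :
    Tens R M Y →+ P :=
  QuotientAddGroup.lift (balancedRel R M Y)
    (TensorProduct.liftAddHom F (fun n m y => by
      rw [map_zsmul, map_zsmul, AddMonoidHom.zsmul_apply]))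
    (by
      rw [balancedRel, AddSubgroup.closure_le]
      rintro _ ⟨m, r, y, rfl⟩
      simp [hF])

theorem tensLift_tmul (F : M →+ Y →+ P)
    (hF : ∀ (m : M) (r : R) (y : Y), F (op r • m) y = F m (r • y)) (m : M) (y : Y) :
    tensLift R F hF (tmul R m y) = F m y := rfl

/-- `1_M ⊗ h : M ⊗_R Y → M ⊗_R Z` for an `R`-linear map `h : Y → Z`. -/
def lTens (M : Type u) [AddCommGroup M] [Module Rᵐᵒᵖ M] (h : Y →ₗ[R] Z) :
    Tens R M Y →+ Tens R M Z :=
  tensLift R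
    (AddMonoidHom.mk' (fun m => AddMonoidHom.mk' (fun y => tmul R m (h y))
      (fun y y' => by rw [map_add, tmul_add]))
      (fun m m' => by ext y; exact add_tmul R m m' (h y)))
    (fun m r y => by
      change tmul R (op r • m) (h y) = tmul R m (h (r • y))
      rw [smul_tmul, map_smul])

theorem lTens_tmul (h : Y →ₗ[R] Z) (m : M) (y : Y) :
    lTens R M h (tmul R m y) = tmul R m (h y) := rfl

variable [Module S M] [SMulCommClass S Rᵐᵒᵖ M]

/-- Multiplication by `s` on `M ⊗_R Y`, for an `S`-`R`-bimodule `M`. -/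
def tensSMul (s : S) : Tens R M Y →+ Tens R M Y :=
  tensLift R
    (AddMonoidHom.mk' (fun m => AddMonoidHom.mk' (fun y => tmul R (s • m) y)
      (fun y y' => tmul_add R (s • m) y y'))
      (fun m m' => by
        ext y
        change tmul R (s • (m + m')) y = tmul R (s • m) y + tmul R (s • m') y
        rw [smul_add, add_tmul]))
    (fun m r y => by
      change tmul R (s • op r • m) y = tmul R (s • m) (r • y)
      rw [smul_comm, smul_tmul])

theorem tensSMul_tmul (s : S) (m : M) (y : Y) :
    tensSMul R s (tmul R m y) = tmul R (s • m) y := rfl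

/-- The left `S`-module structure on `M ⊗_R Y`, for an `S`-`R`-bimodule `M`:
`s (m ⊗ y) = (s m) ⊗ y`. -/
instance (priority := 100) : Module S (Tens R M Y) where
  smul s z := tensSMul R s z
  smul_zero s := map_zero (tensSMul R s)
  smul_add s := map_add (tensSMul R s)
  one_smul z := DFunLike.congr_fun (f := tensSMul R (1 : S)) (g := AddMonoidHom.id _)
    (tens_hom_ext R fun m y => by
      rw [tensSMul_tmul, one_smul, AddMonoidHom.id_apply]) z
  mul_smul s t z := DFunLike.congr_fun (f := tensSMul R (s * t))
    (g := (tensSMul R s).comp (tensSMul R t))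
    (tens_hom_ext R fun m y => by
      rw [AddMonoidHom.comp_apply, tensSMul_tmul, tensSMul_tmul, tensSMul_tmul, mul_smul]) z
  add_smul s t z := DFunLike.congr_fun (f := tensSMul R (s + t))
    (g := tensSMul R s + tensSMul R t)
    (tens_hom_ext R fun m y => by
      rw [AddMonoidHom.add_apply, tensSMul_tmul, tensSMul_tmul, tensSMul_tmul, add_smul,
        add_tmul]) z
  zero_smul z := DFunLike.congr_fun (f := tensSMul R (0 : S)) (g := 0)
    (tens_hom_ext R fun m y => by
      rw [tensSMul_tmul, zero_smul, zero_tmul, AddMonoidHom.zero_apply]) z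

theorem smul_tens_tmul (s : S) (m : M) (y : Y) : s • tmul R m y = tmul R (s • m) y := rfl

end TensorBasics

/-! ### Gorenstein projective modules -/

section Gorenstein

/-- The complex `P` of left `R`-modules is exact. -/
def IsExactComplex {R : Type u} [Ring R] (P : CochainComplex (ModuleCat.{u} R) ℤ) : Prop :=
  ∀ i : ℤ, Function.Exact (P.d i (i + 1)).hom (P.d (i + 1) (i + 1 + 1)).hom

/-- The complex `Hom_R(P, W)` is exact. -/
def HomExact {R : Type u} [Ring R] (P : CochainComplex (ModuleCat.{u} R) ℤ)
    (W : Type u) [AddCommGroup W] [Module R W] : Prop :=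
  ∀ i : ℤ, Function.Exact
    (fun φ : P.X (i + 1 + 1) →ₗ[R] W => φ ∘ₗ (P.d (i + 1) (i + 1 + 1)).hom)
    (fun φ : P.X (i + 1) →ₗ[R] W => φ ∘ₗ (P.d i (i + 1)).hom)

/-- The complex `M ⊗_R P` is exact, for a right `R`-module `M`. -/
def TensExact {R : Type u} [Ring R] (M : Type u) [AddCommGroup M] [Module Rᵐᵒᵖ M]
    (P : CochainComplex (ModuleCat.{u} R) ℤ) : Prop :=
  ∀ i : ℤ, Function.Exact (lTens R M (P.d i (i + 1)).hom)
    (lTens R M (P.d (i + 1) (i + 1 + 1)).hom)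

/-- `P` is a complete `R`-projective resolution: an exact complex of projective `R`-modules such
that `Hom_R(P, Q)` is exact for every projective `R`-module `Q`. -/
structure IsCompleteProjRes {R : Type u} [Ring R]
    (P : CochainComplex (ModuleCat.{u} R) ℤ) : Prop where
  projective : ∀ i : ℤ, Module.Projective R (P.X i)
  exact : IsExactComplex P
  homExact : ∀ (Q : Type u) [AddCommGroup Q] [Module R Q], Module.Projective R Q → HomExact P Q

/-- `G` is a Gorenstein projective left `R`-module: it is isomorphic to the image of the
differential `P⁰ → P¹` of a complete projective resolution `P`. -/
def IsGorensteinProjective (R : Type u) [Ring R] (G : Type u) [AddCommGroup G] [Module R G] :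
    Prop :=
  ∃ P : CochainComplex (ModuleCat.{u} R) ℤ, IsCompleteProjRes P ∧
    Nonempty (G ≃ₗ[R] LinearMap.range (P.d 0 1).hom)

/-- `W` belongs to `Add V`: it is isomorphic to a direct summand of a direct sum of copies
of `V`. -/
def InAdd (R : Type u) [Ring R] (V : Type u) [AddCommGroup V] [Module R V]
    (W : Type u) [AddCommGroup W] [Module R W] : Prop :=
  ∃ (I : Type u) (s : W →ₗ[R] (I →₀ V)) (r : (I →₀ V) →ₗ[R] W), r ∘ₗ s = LinearMap.id

/-- `Hom_R(P, W)` is exact for every `W` in `Add V`. -/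
def HomAddExact {R : Type u} [Ring R] (P : CochainComplex (ModuleCat.{u} R) ℤ)
    (V : Type u) [AddCommGroup V] [Module R V] : Prop :=
  ∀ (W : Type u) [AddCommGroup W] [Module R W], InAdd R V W → HomExact P W

end Gorenstein

/-! ### Morita context rings with zero homomorphisms -/

/-- The underlying set of `Λ₍₀,₀₎`: matrices with rows `(a, m)` and `(n, b)`, where
`a ∈ A`, `m ∈ M`, `n ∈ N`, `b ∈ B`. -/
@[ext]
structure MoritaRing (A B M N : Type u) : Type u where
  a : A
  m : M
  n : N
  b : B

section MoritaRing

variable {A B M N : Type u} [Ring A] [Ring B] [AddCommGroup M] [AddCommGroup N]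

instance : Zero (MoritaRing A B M N) := ⟨⟨0, 0, 0, 0⟩⟩
instance : One (MoritaRing A B M N) := ⟨⟨1, 0, 0, 1⟩⟩
instance : Add (MoritaRing A B M N) := ⟨fun x y => ⟨x.a + y.a, x.m + y.m, x.n + y.n, x.b + y.b⟩⟩
instance : Neg (MoritaRing A B M N) := ⟨fun x => ⟨-x.a, -x.m, -x.n, -x.b⟩⟩

@[simp] theorem zero_a : (0 : MoritaRing A B M N).a = 0 := rfl
@[simp] theorem zero_m : (0 : MoritaRing A B M N).m = 0 := rfl
@[simp] theorem zero_n : (0 : MoritaRing A B M N).n = 0 := rfl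
@[simp] theorem zero_b : (0 : MoritaRing A B M N).b = 0 := rfl
@[simp] theorem one_a : (1 : MoritaRing A B M N).a = 1 := rfl
@[simp] theorem one_m : (1 : MoritaRing A B M N).m = 0 := rfl
@[simp] theorem one_n : (1 : MoritaRing A B M N).n = 0 := rfl
@[simp] theorem one_b : (1 : MoritaRing A B M N).b = 1 := rfl
@[simp] theorem neg_a (x : MoritaRing A B M N) : (-x).a = -x.a := rfl
@[simp] theorem neg_m (x : MoritaRing A B M N) : (-x).m = -x.m := rfl
@[simp] theorem neg_n (x : MoritaRing A B M N) : (-x).n = -x.n := rfl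
@[simp] theorem neg_b (x : MoritaRing A B M N) : (-x).b = -x.b := rfl
@[simp] theorem add_a (x y : MoritaRing A B M N) : (x + y).a = x.a + y.a := rfl
@[simp] theorem add_m (x y : MoritaRing A B M N) : (x + y).m = x.m + y.m := rfl
@[simp] theorem add_n (x y : MoritaRing A B M N) : (x + y).n = x.n + y.n := rfl
@[simp] theorem add_b (x y : MoritaRing A B M N) : (x + y).b = x.b + y.b := rfl

variable [Module A M] [Module Bᵐᵒᵖ M] [Module B N] [Module Aᵐᵒᵖ N]

/-- Matrix multiplication, where the products `M × N → A` and `N × M → B` are zero. -/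
instance : Mul (MoritaRing A B M N) :=
  ⟨fun x y => ⟨x.a * y.a, x.a • y.m + op y.b • x.m, op y.a • x.n + x.b • y.n, x.b * y.b⟩⟩

@[simp] theorem mul_a (x y : MoritaRing A B M N) : (x * y).a = x.a * y.a := rfl
@[simp] theorem mul_m (x y : MoritaRing A B M N) :
    (x * y).m = x.a • y.m + op y.b • x.m := rfl
@[simp] theorem mul_n (x y : MoritaRing A B M N) :
    (x * y).n = op y.a • x.n + x.b • y.n := rfl
@[simp] theorem mul_b (x y : MoritaRing A B M N) : (x * y).b = x.b * y.b := rfl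

variable [SMulCommClass A Bᵐᵒᵖ M] [SMulCommClass B Aᵐᵒᵖ N]

/-- The Morita context ring `Λ₍₀,₀₎` with zero bimodule homomorphisms. -/
instance : Ring (MoritaRing A B M N) where
  add_assoc x y z := by ext <;> simp [add_assoc]
  zero_add x := by ext <;> simp
  add_zero x := by ext <;> simp
  add_comm x y := by ext <;> simp [add_comm]
  neg_add_cancel x := by ext <;> simp
  nsmul := nsmulRec
  zsmul := zsmulRec
  mul_assoc x y z := by
    ext
    · simp [mul_assoc]
    · simp only [mul_a, mul_m, mul_b, smul_add, mul_smul, op_mul, add_assoc]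
      rw [smul_comm x.a (op z.b) y.m]
    · simp only [mul_a, mul_n, mul_b, smul_add, mul_smul, op_mul, add_assoc]
      rw [smul_comm x.b (op z.a) y.n]
    · simp [mul_assoc]
  one_mul x := by ext <;> simp
  mul_one x := by ext <;> simp
  zero_mul x := by ext <;> simp
  mul_zero x := by ext <;> simp
  left_distrib x y z := by
    ext
    · simp [mul_add]
    · simp only [mul_m, add_m, add_b, smul_add, op_add, add_smul]; abel
    · simp only [mul_n, add_n, add_a, smul_add, op_add, add_smul]; abel
    · simp [mul_add]
  right_distrib x y z := by
    ext
    · simp [add_mul]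
    · simp only [mul_m, add_m, add_a, smul_add, add_smul]; abel
    · simp only [mul_n, add_n, add_b, smul_add, add_smul]; abel
    · simp [add_mul]

/-- The ring homomorphism `Λ₍₀,₀₎ → A × B` onto the diagonal. -/
def diagHom (A B M N : Type u) [Ring A] [Ring B]
    [AddCommGroup M] [Module A M] [Module Bᵐᵒᵖ M] [SMulCommClass A Bᵐᵒᵖ M]
    [AddCommGroup N] [Module B N] [Module Aᵐᵒᵖ N] [SMulCommClass B Aᵐᵒᵖ N] :
    MoritaRing A B M N →+* A × B where
  toFun x := (x.a, x.b)
  map_zero' := rfl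
  map_one' := rfl
  map_add' _ _ := rfl
  map_mul' _ _ := rfl

end MoritaRing

/-- `A × B` as a `Λ₍₀,₀₎`-`Λ₍₀,₀₎`-bimodule through `diagHom`. As a left module it is
the module `(A, B, 0, 0)`. -/
@[nolint unusedArguments]
def Diag (A B : Type u) (_M _N : Type u) : Type u := A × B

section Diag

variable {A B M N : Type u} [Ring A] [Ring B]
  [AddCommGroup M] [Module A M] [Module Bᵐᵒᵖ M] [SMulCommClass A Bᵐᵒᵖ M]
  [AddCommGroup N] [Module B N] [Module Aᵐᵒᵖ N] [SMulCommClass B Aᵐᵒᵖ N]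

instance : AddCommGroup (Diag A B M N) := inferInstanceAs (AddCommGroup (A × B))

/-- The left action `λ (x, y) = (a x, b y)`. -/
instance : Module (MoritaRing A B M N) (Diag A B M N) :=
  letI : Module (A × B) (Diag A B M N) := inferInstanceAs (Module (A × B) (A × B))
  Module.compHom (Diag A B M N) (diagHom A B M N)

/-- The right action `(x, y) λ = (x a, y b)`. -/
instance : Module (MoritaRing A B M N)ᵐᵒᵖ (Diag A B M N) :=
  letI : Module (A × B)ᵐᵒᵖ (Diag A B M N) := inferInstanceAs (Module (A × B)ᵐᵒᵖ (A × B))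
  Module.compHom (Diag A B M N) (diagHom A B M N).op

theorem diag_smul (l : MoritaRing A B M N) (p : A × B) :
    l • (show Diag A B M N from p) = (show Diag A B M N from (l.a * p.1, l.b * p.2)) := rfl

theorem diag_op_smul (l : MoritaRing A B M N) (p : A × B) :
    op l • (show Diag A B M N from p) = (show Diag A B M N from (p.1 * l.a, p.2 * l.b)) := rfl

end Diag

section Quadruple

variable {A B M N X Y : Type u} [Ring A] [Ring B]
  [AddCommGroup M] [Module A M] [Module Bᵐᵒᵖ M] [SMulCommClass A Bᵐᵒᵖ M]
  [AddCommGroup N] [Module B N] [Module Aᵐᵒᵖ N] [SMulCommClass B Aᵐᵒᵖ N]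
  [AddCommGroup X] [Module A X] [AddCommGroup Y] [Module B Y]

/-- The `Λ₍₀,₀₎`-module given by a quadruple `(X, Y, f, g)` such that `g ∘ (1_M ⊗ f) = 0` and
`f ∘ (1_N ⊗ g) = 0`. The underlying group is `X × Y`. -/
@[nolint unusedArguments]
def QuadMod (f : Tens A N X →ₗ[B] Y) (g : Tens B M Y →ₗ[A] X)
    (_hgf : ∀ z, g (lTens B M f z) = 0) (_hfg : ∀ z, f (lTens A N g z) = 0) : Type u :=
  X × Y

variable (f : Tens A N X →ₗ[B] Y) (g : Tens B M Y →ₗ[A] X)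
  (hgf : ∀ z, g (lTens B M f z) = 0) (hfg : ∀ z, f (lTens A N g z) = 0)

instance : AddCommGroup (QuadMod f g hgf hfg) := inferInstanceAs (AddCommGroup (X × Y))

/-- The action of the matrix with rows `(a, m)`, `(n, b)` on the column `(x, y)`:
`(a x + g (m ⊗ y), f (n ⊗ x) + b y)`. -/
instance : Module (MoritaRing A B M N) (QuadMod f g hgf hfg) where
  smul l p := (show X × Y from
    (l.a • p.1 + g (tmul B l.m p.2), f (tmul A l.n p.1) + l.b • p.2))
  smul_zero l := by
    refine Prod.ext ?_ ?_
    · change l.a • (0 : X) + g (tmul B l.m (0 : Y)) = 0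
      rw [tmul_zero, map_zero, smul_zero, add_zero]
    · change f (tmul A l.n (0 : X)) + l.b • (0 : Y) = 0
      rw [tmul_zero, map_zero, smul_zero, add_zero]
  smul_add l p q := by
    refine Prod.ext ?_ ?_
    · change l.a • (p.1 + q.1) + g (tmul B l.m (p.2 + q.2)) =
        (l.a • p.1 + g (tmul B l.m p.2)) + (l.a • q.1 + g (tmul B l.m q.2))
      rw [tmul_add, map_add, smul_add]; abel
    · change f (tmul A l.n (p.1 + q.1)) + l.b • (p.2 + q.2) =
        (f (tmul A l.n p.1) + l.b • p.2) + (f (tmul A l.n q.1) + l.b • q.2)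
      rw [tmul_add, map_add, smul_add]; abel
  one_smul p := by
    refine Prod.ext ?_ ?_
    · change (1 : A) • p.1 + g (tmul B (0 : M) p.2) = p.1
      rw [zero_tmul, map_zero, one_smul, add_zero]
    · change f (tmul A (0 : N) p.1) + (1 : B) • p.2 = p.2
      rw [zero_tmul, map_zero, one_smul, zero_add]
  zero_smul p := by
    refine Prod.ext ?_ ?_
    · change (0 : A) • p.1 + g (tmul B (0 : M) p.2) = 0
      rw [zero_tmul, map_zero, zero_smul, add_zero]
    · change f (tmul A (0 : N) p.1) + (0 : B) • p.2 = 0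
      rw [zero_tmul, map_zero, zero_smul, zero_add]
  add_smul l k p := by
    refine Prod.ext ?_ ?_
    · change (l.a + k.a) • p.1 + g (tmul B (l.m + k.m) p.2) =
        (l.a • p.1 + g (tmul B l.m p.2)) + (k.a • p.1 + g (tmul B k.m p.2))
      rw [add_tmul, map_add, add_smul]; abel
    · change f (tmul A (l.n + k.n) p.1) + (l.b + k.b) • p.2 =
        (f (tmul A l.n p.1) + l.b • p.2) + (f (tmul A k.n p.1) + k.b • p.2)
      rw [add_tmul, map_add, add_smul]; abel
  mul_smul l k p := by
    refine Prod.ext ?_ ?_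
    · change (l.a * k.a) • p.1 + g (tmul B (l.a • k.m + op k.b • l.m) p.2) =
        l.a • (k.a • p.1 + g (tmul B k.m p.2)) +
          g (tmul B l.m (f (tmul A k.n p.1) + k.b • p.2))
      have h := hgf (tmul B l.m (tmul A k.n p.1))
      rw [lTens_tmul] at h
      rw [tmul_add, add_tmul, map_add, map_add, h, smul_tmul, ← smul_tens_tmul, map_smul,
        mul_smul, smul_add, zero_add, add_assoc]
    · change f (tmul A (op k.a • l.n + l.b • k.n) p.1) + (l.b * k.b) • p.2 =
        f (tmul A l.n (k.a • p.1 + g (tmul B k.m p.2))) +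
          l.b • (f (tmul A k.n p.1) + k.b • p.2)
      have h := hfg (tmul A l.n (tmul B k.m p.2))
      rw [lTens_tmul] at h
      rw [tmul_add, add_tmul, map_add, map_add, h, smul_tmul, ← smul_tens_tmul, map_smul,
        mul_smul, smul_add, add_zero, add_assoc]

end Quadruple

end MoritaGP

open MoritaGP

/-! A module is Gorenstein projective once it lies in a class in which every member is both the
kernel and the cokernel term of a short exact sequence with projective middle term and other end in
the class, exact under Hom into projectives: splicing such sequences gives a complete resolution
(`isGorensteinProjective_of_class`). Both implications between (1) and (3) exhibit such a class. The
hypotheses enter by dimension shifting: if `M ⊗ -` or `Hom(-, W)` preserves exactness of complete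
resolutions, then Tor₁(M, G) = 0 or Ext¹(G, W) = 0 for Gorenstein projective G, in the form of
`IsGorensteinProjective.lTens_injective` and `IsGorensteinProjective.exists_extension`.

(3) ⇒ (1): the class consists of the quadruples satisfying (3), `Quad.IsCompatible`. Projective
Λ-modules are the summands of induced modules (V ⊕ M ⊗ V', V' ⊕ N ⊗ V) with V, V' projective. Embed
Coker g in P and Coker f in P', with P, P' projective and Gorenstein projective quotients. Since 0 →
M ⊗ Coker f → X → Coker g → 0 is exact and Ext¹(Coker g, M ⊗ P') = 0, the map M ⊗ Coker f → M ⊗ P'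
extends to X; with its mirror image this embeds (X, Y) in the module induced from (P, P'). Covers
come from lifting projective surjections onto the two cokernels. Diagram chases and Tor₁ vanishing
show that the new quadruples again satisfy (3).

(1) ⇒ (3): (A × B) ⊗_Λ Z is Coker g ⊕ Coker f, and maps from Z to (W, 0, 0, 0) are maps Coker g → W.
Condition 2 therefore turns each syzygy step over Λ into syzygy steps for both cokernels. Exactness
in (3) holds for projectives and descends to Z by vanishing of Tor₁ on the cokernels of the next
cosyzygy.

(2) ⇔ (3) is right exactness of the tensor product. Statements about X and g give those about Y and
f by interchanging A and B. -/

namespace MoritaGP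

/-! ### Factoring linear maps through cokernels and kernels -/

section Factor

variable {R : Type u} [Ring R] {K E G W : Type u} [AddCommGroup K] [Module R K] [AddCommGroup E]
  [Module R E] [AddCommGroup G] [Module R G] [AddCommGroup W] [Module R W]

theorem exists_desc {i : K →ₗ[R] E} {p : E →ₗ[R] G} (hip : Function.Exact i p)
    (hp : Function.Surjective p) (φ : E →ₗ[R] W) (hφ : ∀ k, φ (i k) = 0) :
    ∃ ψ : G →ₗ[R] W, ∀ x, ψ (p x) = φ x := by
  have hk : LinearMap.ker p ≤ LinearMap.ker φ := by
    intro z hz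
    obtain ⟨w, rfl⟩ := (hip z).1 hz
    exact hφ w
  refine ⟨(LinearMap.ker p).liftQ φ hk ∘ₗ (p.quotKerEquivOfSurjective hp).symm.toLinearMap,
    fun x => ?_⟩
  have h1 : (p.quotKerEquivOfSurjective hp).symm (p x) = Submodule.Quotient.mk x := by
    rw [LinearEquiv.symm_apply_eq]; rfl
  simp [h1]

theorem exists_lift {i : K →ₗ[R] E} {p : E →ₗ[R] G} (hi : Function.Injective i)
    (hip : Function.Exact i p) (φ : W →ₗ[R] E) (hφ : ∀ w, p (φ w) = 0) :
    ∃ ψ : W →ₗ[R] K, ∀ w, i (ψ w) = φ w := by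
  let e := LinearEquiv.ofInjective i hi
  have hr : ∀ w, φ w ∈ LinearMap.range i := fun w => (hip _).1 (hφ w)
  exact ⟨e.symm.toLinearMap ∘ₗ φ.codRestrict _ hr, fun w =>
    congrArg Subtype.val (e.apply_symm_apply (⟨φ w, hr w⟩ : LinearMap.range i))⟩

end Factor

/-! ### Functoriality and right exactness of the tensor product -/

section TensorLemmas

variable {R S : Type u} [Ring R] [Ring S] (M : Type u) [AddCommGroup M] [Module Rᵐᵒᵖ M]
  {K E G W : Type u} [AddCommGroup K] [Module R K] [AddCommGroup E] [Module R E]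
  [AddCommGroup G] [Module R G] [AddCommGroup W] [Module R W]

theorem lTens_comp (h : E →ₗ[R] G) (k : K →ₗ[R] E) (z : Tens R M K) :
    lTens R M (h ∘ₗ k) z = lTens R M h (lTens R M k z) :=
  DFunLike.congr_fun (f := lTens R M (h ∘ₗ k)) (g := (lTens R M h).comp (lTens R M k))
    (tens_hom_ext R fun _ _ => rfl) z

theorem lTens_id (z : Tens R M K) : lTens R M (LinearMap.id : K →ₗ[R] K) z = z :=
  DFunLike.congr_fun (f := lTens R M LinearMap.id) (g := AddMonoidHom.id _)
    (tens_hom_ext R fun _ _ => rfl) z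

theorem lTens_zero (z : Tens R M K) : lTens R M (0 : K →ₗ[R] E) z = 0 :=
  DFunLike.congr_fun (f := lTens R M (0 : K →ₗ[R] E)) (g := 0)
    (tens_hom_ext R fun m _ => tmul_zero R m) z

theorem lTens_surjective {h : E →ₗ[R] G} (hh : Function.Surjective h) :
    Function.Surjective (lTens R M h) := by
  intro z
  refine tens_induction R (p := fun z => ∃ w, lTens R M h w = z) ⟨0, map_zero _⟩ ?_ ?_ z
  · intro m y
    obtain ⟨x, rfl⟩ := hh y
    exact ⟨tmul R m x, rfl⟩
  · rintro _ _ ⟨a, rfl⟩ ⟨b, rfl⟩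
    exact ⟨a + b, map_add _ _ _⟩

/-- The functor `M ⊗_R -` is right exact. -/
theorem lTens_exact {i : K →ₗ[R] E} {p : E →ₗ[R] G} (hip : Function.Exact i p)
    (hp : Function.Surjective p) : Function.Exact (lTens R M i) (lTens R M p) := by
  intro z
  constructor
  · intro hz
    -- The class of m ⊗ x modulo the image of `1 ⊗ i` depends only on m and `p x`. So a
    -- set-theoretic section of `p` defines a map Φ from M ⊗ G to this quotient with Φ ∘ (1 ⊗ p) =
    -- q; whatever `1 ⊗ p` kills is then killed by `q`.
    let q := QuotientAddGroup.mk' (lTens R M i).range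
    have hq : ∀ (m : M) (x y : E), p x = p y → q (tmul R m x) = q (tmul R m y) := by
      intro m x y hxy
      have h0 : p (x - y) = 0 := by rw [map_sub, hxy, sub_self]
      obtain ⟨k, hk⟩ := (hip _).1 h0
      have h1 : x = i k + y := by rw [hk, sub_add_cancel]
      rw [h1, tmul_add, map_add, ← lTens_tmul]
      have h2 : q (lTens R M i (tmul R m k)) = 0 :=
        (QuotientAddGroup.eq_zero_iff _).2 ⟨_, rfl⟩
      rw [h2, zero_add]
    let s := Function.surjInv hp
    have hs : ∀ x, p (s x) = x := Function.surjInv_eq hp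
    let F : M →+ G →+ _ := AddMonoidHom.mk' (fun m => AddMonoidHom.mk'
        (fun x => q (tmul R m (s x))) (fun x y => by
          rw [← map_add, ← tmul_add]
          exact hq _ _ _ (by rw [hs, map_add, hs, hs])))
      (fun m m' => by
        ext x
        change q (tmul R (m + m') (s x)) = q (tmul R m (s x)) + q (tmul R m' (s x))
        rw [add_tmul, map_add])
    let Φ := tensLift R F (fun m r x => by
      change q (tmul R (op r • m) (s x)) = q (tmul R m (s (r • x)))
      rw [smul_tmul]
      exact hq _ _ _ (by rw [hs, map_smul, hs]))
    have hΦ : Φ.comp (lTens R M p) = q := tens_hom_ext R fun m y => hq _ _ _ (hs _)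
    have h3 : q z = 0 := by
      rw [← hΦ, AddMonoidHom.comp_apply, hz, map_zero]
    exact (QuotientAddGroup.eq_zero_iff _).1 h3
  · rintro ⟨w, rfl⟩
    rw [← lTens_comp, hip.linearMap_comp_eq_zero, lTens_zero]

variable [Module S M] [SMulCommClass S Rᵐᵒᵖ M]

/-- `1_M ⊗ h` as an `S`-linear map, for an `S`-`R`-bimodule `M`. -/
def lTensₗ (S : Type u) [Ring S] (M : Type u) [AddCommGroup M] [Module Rᵐᵒᵖ M]
    [Module S M] [SMulCommClass S Rᵐᵒᵖ M] (h : E →ₗ[R] G) : Tens R M E →ₗ[S] Tens R M G where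
  toFun := lTens R M h
  map_add' := map_add _
  map_smul' s z := DFunLike.congr_fun (f := (lTens R M h).comp (tensSMul R s))
    (g := (tensSMul R s).comp (lTens R M h)) (tens_hom_ext R fun _ _ => rfl) z

@[simp]
theorem lTensₗ_apply (h : E →ₗ[R] G) (z : Tens R M E) : lTensₗ S M h z = lTens R M h z := rfl

theorem tens_hom_ext' {P : Type u} [AddCommGroup P] [Module S P] {φ ψ : Tens R M E →ₗ[S] P}
    (h : ∀ m y, φ (tmul R m y) = ψ (tmul R m y)) : φ = ψ :=
  LinearMap.toAddMonoidHom_injective (tens_hom_ext R h)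

/-- An `S`-linear map `M ⊗_R E → P` that kills the image of `1_M ⊗ i` factors through
`M ⊗_R G` if `K → E → G → 0` is exact. -/
theorem exists_tens_desc {P : Type u} [AddCommGroup P] [Module S P]
    {i : K →ₗ[R] E} {p : E →ₗ[R] G} (hip : Function.Exact i p) (hp : Function.Surjective p)
    (φ : Tens R M E →ₗ[S] P) (hφ : ∀ z, φ (lTens R M i z) = 0) :
    ∃ ψ : Tens R M G →ₗ[S] P, ∀ z, ψ (lTens R M p z) = φ z := by
  refine exists_desc (LinearMap.exact_subtype_ker_map (lTensₗ S M p)) (lTens_surjective M hp) φ ?_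
  rintro ⟨z, hz⟩
  obtain ⟨w, rfl⟩ := (lTens_exact M hip hp z).1 hz
  exact hφ w

/-- `M ⊗_R P` is in `Add M` if `P` is projective. -/
theorem inAdd_tens (hE : Module.Projective R E) : InAdd S M (Tens R M E) := by
  -- `s` writes x as a finite combination of elements e with coefficients r_e. The section sends m ⊗
  -- x to the family (m r_e), the retraction sends (m_e) to the sum of the m_e ⊗ e, and their
  -- composite is m ⊗ Σ r_e e = m ⊗ x.
  obtain ⟨s, hs⟩ := Module.projective_def'.1 hE
  let F : M →+ E →+ (E →₀ M) := AddMonoidHom.mk' (fun m => AddMonoidHom.mk'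
      (fun x => (s x).mapRange (fun r => op r • m) (by simp))
      (fun x y => by ext; simp [add_smul]))
    (fun m m' => by ext; simp)
  let σ := tensLift R F (fun m r x => by
    ext j
    change op (s x j) • op r • m = op (s (r • x) j) • m
    rw [map_smul, Finsupp.smul_apply, smul_eq_mul, op_mul, mul_smul])
  have hσ : ∀ m x, σ (tmul R m x) = (s x).mapRange (fun r => op r • m) (by simp) :=
    fun _ _ => rfl
  let σ' : Tens R M E →ₗ[S] (E →₀ M) :=
    { toFun := σ
      map_add' := map_add σ
      map_smul' := fun t z => by
        refine DFunLike.congr_fun (f := σ.comp (tensSMul R t))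
          (g := (DistribSMul.toAddMonoidHom (E →₀ M) t).comp σ)
          (tens_hom_ext R fun m x => ?_) z
        change σ (tmul R (t • m) x) = t • σ (tmul R m x)
        ext j
        simp [hσ, smul_comm] }
  let ρ : (E →₀ M) →ₗ[S] Tens R M E := Finsupp.lsum ℕ fun e : E =>
    { toFun := fun m => tmul R m e
      map_add' := fun m m' => add_tmul R m m' e
      map_smul' := fun t m => (smul_tens_tmul R t m e).symm }
  refine ⟨E, σ', ρ, tens_hom_ext' M fun m x => ?_⟩
  have key : ∀ v : E →₀ R, ρ (v.mapRange (fun r => op r • m) (by simp)) =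
      tmul R m (Finsupp.linearCombination R id v) := by
    intro v
    induction v using Finsupp.induction_linear with
    | zero => simp [tmul_zero]
    | add a b ha hb =>
      rw [Finsupp.mapRange_add (by intro a b; simp [add_smul]), map_add, ha, hb, map_add,
        tmul_add]
    | single e r =>
      simp only [Finsupp.mapRange_single, Finsupp.linearCombination_single, id]
      rw [← smul_tmul]
      exact Finsupp.sum_single_index (zero_tmul R e)
  change ρ (σ (tmul R m x)) = tmul R m x
  rw [hσ, key]
  exact congrArg _ (DFunLike.congr_fun hs x)

end TensorLemmas

/-! ### Complete resolutions: splicing, syzygies, and vanishing of Ext¹ and Tor₁ -/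

section GorensteinLemmas

variable {R : Type u} [Ring R]

/-- `0 → K → E → G → 0` is exact. -/
structure IsShortExact {K E G : Type u} [AddCommGroup K] [Module R K] [AddCommGroup E] [Module R E]
    [AddCommGroup G] [Module R G] (i : K →ₗ[R] E) (p : E →ₗ[R] G) : Prop where
  inj : Function.Injective i
  exact : Function.Exact i p
  surj : Function.Surjective p

/-- There is a short exact sequence `0 → K → P → G → 0` with `P` projective that stays exact
under `Hom(-, Q)` for projective `Q`. -/
def ProjStep (K G : ModuleCat.{u} R) : Prop :=
  ∃ (P : ModuleCat.{u} R) (i : K →ₗ[R] P) (p : P →ₗ[R] G), Module.Projective R P ∧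
    IsShortExact i p ∧ ∀ (Q : Type u) [AddCommGroup Q] [Module R Q], Module.Projective R Q →
      ∀ φ : K →ₗ[R] Q, ∃ ψ : P →ₗ[R] Q, ψ ∘ₗ i = φ

/-- Iterated choice in both directions. The prescribed value sits at index 1 because the spliced
differential `d 0` has image the module of index 1. -/
theorem exists_int_chain {α : Type*} (r : α → α → Prop) (hr : ∀ a, ∃ b, r a b)
    (hl : ∀ b, ∃ a, r a b) (c : α) : ∃ s : ℤ → α, s 1 = c ∧ ∀ i, r (s i) (s (i + 1)) := by
  choose next hnext using hr
  choose prev hprev using hl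
  let s : ℤ → α
    | .ofNat 0 => prev c
    | .ofNat (n + 1) => next^[n] c
    | .negSucc n => prev^[n + 2] c
  refine ⟨s, rfl, ?_⟩
  rintro ((_ | n) | (_ | n))
  · exact hprev c
  · change r (next^[n] c) (next^[n + 1] c)
    rw [Function.iterate_succ_apply']
    exact hnext _
  · exact hprev (prev c)
  · change r (prev^[n + 3] c) (prev^[n + 2] c)
    rw [Function.iterate_succ_apply' prev (n + 2)]
    exact hprev _

/-- A class of modules in which every module is both a syzygy and a cosyzygy of a module in the
class consists of Gorenstein projective modules. -/
theorem isGorensteinProjective_of_class (C : ModuleCat.{u} R → Prop)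
    (hr : ∀ K, C K → ∃ G, C G ∧ ProjStep K G) (hl : ∀ G, C G → ∃ K, C K ∧ ProjStep K G)
    (G : ModuleCat.{u} R) (hG : C G) : IsGorensteinProjective R G := by
  obtain ⟨s, hs1, hs⟩ := exists_int_chain (α := {G // C G}) (fun K G => ProjStep K.1 G.1)
    (fun K => by
      obtain ⟨G, h1, h2⟩ := hr K.1 K.2
      exact ⟨⟨G, h1⟩, h2⟩)
    (fun G => by
      obtain ⟨K, h1, h2⟩ := hl G.1 G.2
      exact ⟨⟨K, h1⟩, h2⟩) ⟨G, hG⟩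
  choose P i p hP hip hQ using hs
  -- The n-th sequence is 0 → s n → P n → s (n + 1) → 0, so the differential passes through s (n +
  -- 1).
  let d : ∀ n : ℤ, P n ⟶ P (n + 1) := fun n => ModuleCat.ofHom (i (n + 1) ∘ₗ p n)
  have hd : ∀ n x, (d n).hom x = i (n + 1) (p n x) := fun _ _ => rfl
  have hdd : ∀ n, CategoryTheory.CategoryStruct.comp (d n) (d (n + 1)) = 0 := by
    intro n
    ext x
    change i (n + 1 + 1) (p (n + 1) (i (n + 1) (p n x))) = 0
    rw [(hip (n + 1)).exact.apply_apply_eq_zero, map_zero]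
  have hC : ∀ n, (CochainComplex.of (fun n => P n) d hdd).d n (n + 1) = d n :=
    CochainComplex.of_d _ d
  refine ⟨CochainComplex.of (fun n => P n) d hdd, ⟨hP, ?_, ?_⟩, ?_⟩
  · intro n
    rw [hC, hC]
    intro x
    change i (n + 1 + 1) (p (n + 1) x) = 0 ↔ ∃ y, i (n + 1) (p n y) = x
    rw [map_eq_zero_iff _ (hip (n + 1 + 1)).inj, (hip (n + 1)).exact]
    constructor
    · rintro ⟨z, rfl⟩
      obtain ⟨y, rfl⟩ := (hip n).surj z
      exact ⟨y, rfl⟩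
    · rintro ⟨y, rfl⟩
      exact ⟨_, rfl⟩
  · intro Q _ _ hQp n
    rw [hC, hC]
    intro φ
    constructor
    · intro hφ
      change (φ : P (n + 1) →ₗ[R] Q) ∘ₗ (i (n + 1) ∘ₗ p n) = 0 at hφ
      -- A cocycle vanishes on the submodule s (n + 1), hence descends to s (n + 2), and then
      -- extends to P (n + 2) by the Hom condition of the next step.
      have h0 : ∀ z, φ (i (n + 1) z) = 0 := by
        intro z
        obtain ⟨y, rfl⟩ := (hip n).surj z
        exact DFunLike.congr_fun hφ y
      obtain ⟨χ, hχ⟩ := exists_desc (hip (n + 1)).exact (hip (n + 1)).surj φ h0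
      obtain ⟨ψ, hψ⟩ := hQ (n + 1 + 1) Q hQp χ
      refine ⟨ψ, ?_⟩
      ext x
      exact (DFunLike.congr_fun hψ (p (n + 1) x)).trans (hχ x)
    · rintro ⟨ψ, rfl⟩
      ext x
      change ψ (i (n + 1 + 1) (p (n + 1) (i (n + 1) (p n x)))) = 0
      rw [(hip (n + 1)).exact.apply_apply_eq_zero, map_zero, map_zero]
  · rw [show (CochainComplex.of (fun n => P n) d hdd).d 0 1 = d 0 from hC 0]
    have h1 : LinearMap.range (d 0).hom = LinearMap.range (i 1) := by
      change LinearMap.range (i 1 ∘ₗ p 0) = _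
      rw [LinearMap.range_comp, LinearMap.range_eq_top.2 (hip 0).surj, Submodule.map_top]
    rw [h1]
    have h2 : G = (s 1).1 := by rw [hs1]
    exact ⟨(CategoryTheory.eqToIso h2).toLinearEquiv.trans (LinearEquiv.ofInjective (i 1) (hip 1).inj)⟩

theorem IsGorensteinProjective.of_equiv {G H : Type u} [AddCommGroup G] [Module R G]
    [AddCommGroup H] [Module R H] (h : IsGorensteinProjective R G) (e : H ≃ₗ[R] G) :
    IsGorensteinProjective R H := by
  obtain ⟨P, hP, ⟨e'⟩⟩ := h
  exact ⟨P, hP, ⟨e.trans e'⟩⟩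

/-- The complex `P` with degrees shifted by `n`, without signs. -/
def reindex (P : CochainComplex (ModuleCat.{u} R) ℤ) (n : ℤ) :
    CochainComplex (ModuleCat.{u} R) ℤ where
  X i := P.X (i + n)
  d i j := P.d (i + n) (j + n)
  shape i j h := P.shape _ _ (fun h' => h (by
    change i + n + 1 = j + n at h'
    change i + 1 = j
    omega))
  d_comp_d' _ _ _ _ _ := P.d_comp_d _ _ _

/-- Shifted degrees such as `i + 1 + n` and `i + n + 1` agree only propositionally; free indices
with equations avoid transport along them. The two variants below serve the same purpose. -/
theorem IsExactComplex.exact_of_eq {P : CochainComplex (ModuleCat.{u} R) ℤ}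
    (h : IsExactComplex P) (i j k : ℤ) (hij : i + 1 = j) (hjk : j + 1 = k) :
    Function.Exact (P.d i j).hom (P.d j k).hom := by
  subst hij hjk; exact h i

theorem HomExact.exact_of_eq {P : CochainComplex (ModuleCat.{u} R) ℤ}
    {W : Type u} [AddCommGroup W] [Module R W]
    (h : HomExact P W) (i j k : ℤ) (hij : i + 1 = j) (hjk : j + 1 = k) :
    Function.Exact (fun φ : P.X k →ₗ[R] W => φ ∘ₗ (P.d j k).hom)
      (fun φ : P.X j →ₗ[R] W => φ ∘ₗ (P.d i j).hom) := by
  subst hij hjk; exact h i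

theorem TensExact.exact_of_eq {P : CochainComplex (ModuleCat.{u} R) ℤ}
    {M : Type u} [AddCommGroup M] [Module Rᵐᵒᵖ M]
    (h : TensExact M P) (i j k : ℤ) (hij : i + 1 = j) (hjk : j + 1 = k) :
    Function.Exact (lTens R M (P.d i j).hom) (lTens R M (P.d j k).hom) := by
  subst hij hjk; exact h i

theorem IsCompleteProjRes.reindex {P : CochainComplex (ModuleCat.{u} R) ℤ}
    (h : IsCompleteProjRes P) (n : ℤ) : IsCompleteProjRes (reindex P n) where
  projective i := h.projective (i + n)
  exact i := h.exact.exact_of_eq _ _ _ (by omega) (by omega)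
  homExact Q _ _ hQ i := (h.homExact Q hQ).exact_of_eq _ _ _ (by omega) (by omega)

variable {G : Type u} [AddCommGroup G] [Module R G]

theorem IsCompleteProjRes.isGorensteinProjective_range {P : CochainComplex (ModuleCat.{u} R) ℤ}
    (h : IsCompleteProjRes P) (i j : ℤ) (hij : i + 1 = j) :
    IsGorensteinProjective R (LinearMap.range (P.d i j).hom) := by
  obtain rfl : j = 1 + i := by omega
  have h0 : (0 : ℤ) + i = i := zero_add i
  -- The shifted complex has its differential 0 → 1 in source degree `0 + i`; generalising that
  -- degree allows substitution.
  have : ∀ k, k = i → Nonempty (LinearMap.range (P.d i (1 + i)).hom ≃ₗ[R]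
      LinearMap.range (P.d k (1 + i)).hom) := by
    rintro _ rfl; exact ⟨LinearEquiv.refl _ _⟩
  exact ⟨MoritaGP.reindex P i, h.reindex i, this _ h0⟩

theorem isShortExact_range {P : CochainComplex (ModuleCat.{u} R) ℤ}
    (h : IsExactComplex P) (i j k : ℤ) (hij : i + 1 = j) (hjk : j + 1 = k) :
    IsShortExact (LinearMap.range (P.d i j).hom).subtype (P.d j k).hom.rangeRestrict where
  inj := Subtype.val_injective
  exact x := by
    rw [← map_eq_zero_iff (LinearMap.range (P.d j k).hom).subtype Subtype.val_injective]
    change (P.d j k).hom x = 0 ↔ _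
    rw [h.exact_of_eq i j k hij hjk x]
    simp
  surj := LinearMap.surjective_rangeRestrict _

/-- A Gorenstein projective module embeds into a projective module with Gorenstein projective
cokernel. -/
theorem IsGorensteinProjective.exists_cosyzygy (h : IsGorensteinProjective R G) :
    ∃ (P G' : ModuleCat.{u} R) (i : G →ₗ[R] P) (p : P →ₗ[R] G'), Module.Projective R P ∧
      IsGorensteinProjective R G' ∧ IsShortExact i p := by
  obtain ⟨P, hP, ⟨e⟩⟩ := h
  have hs := isShortExact_range hP.exact 0 1 2 rfl rfl
  refine ⟨P.X 1, ModuleCat.of R (LinearMap.range (P.d 1 2).hom),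
    (LinearMap.range (P.d 0 1).hom).subtype ∘ₗ e.toLinearMap, (P.d 1 2).hom.rangeRestrict,
    hP.projective 1, hP.isGorensteinProjective_range 1 2 rfl, ⟨?_, ?_, hs.surj⟩⟩
  · exact hs.inj.comp e.injective
  · intro x
    rw [hs.exact x]
    change _ ↔ x ∈ Set.range ((LinearMap.range (P.d 0 1).hom).subtype ∘ e)
    rw [e.surjective.range_comp]

/-- A Gorenstein projective module `G` has a surjection `P → G` from a projective module with
Gorenstein projective kernel `K`, such that `Hom(P, W) → Hom(K, W)` is surjective if `Hom(-, W)` preserves the exactness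
of complete projective resolutions, and `M ⊗ K → M ⊗ P` is injective if `M ⊗ -` does. -/
theorem IsGorensteinProjective.exists_syzygy (h : IsGorensteinProjective R G) :
    ∃ (P K : ModuleCat.{u} R) (i : K →ₗ[R] P) (p : P →ₗ[R] G), Module.Projective R P ∧
      IsGorensteinProjective R K ∧ IsShortExact i p ∧
      (∀ (W : Type u) [AddCommGroup W] [Module R W],
        (∀ C : CochainComplex (ModuleCat.{u} R) ℤ, IsCompleteProjRes C → HomExact C W) →
          ∀ φ : K →ₗ[R] W, ∃ ψ : P →ₗ[R] W, ψ ∘ₗ i = φ) ∧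
      (∀ (M : Type u) [AddCommGroup M] [Module Rᵐᵒᵖ M],
        (∀ C : CochainComplex (ModuleCat.{u} R) ℤ, IsCompleteProjRes C → TensExact M C) →
          Function.Injective (lTens R M i)) := by
  obtain ⟨P, hP, ⟨e⟩⟩ := h
  have hs := isShortExact_range hP.exact (-1) 0 1 rfl rfl
  have hs' := isShortExact_range hP.exact (-2) (-1) 0 rfl rfl
  refine ⟨P.X 0, ModuleCat.of R (LinearMap.range (P.d (-1) 0).hom),
    (LinearMap.range (P.d (-1) 0).hom).subtype,
    e.symm.toLinearMap ∘ₗ (P.d 0 1).hom.rangeRestrict,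
    hP.projective 0, hP.isGorensteinProjective_range (-1) 0 rfl, ⟨hs.inj, ?_, ?_⟩, ?_, ?_⟩
  · intro x
    rw [← hs.exact x]
    exact e.symm.map_eq_zero_iff
  · exact e.symm.surjective.comp hs.surj
  · intro W _ _ hW φ
    -- Composed with P⁻¹ → K, the map φ is a cocycle, since d⁻¹ d⁻² = 0. Exactness writes it as ψ ∘
    -- d⁻¹, so ψ restricts to φ on K.
    obtain ⟨ψ, hψ⟩ := ((hW P hP).exact_of_eq (-2) (-1) 0 rfl rfl
      (φ ∘ₗ (P.d (-1) 0).hom.rangeRestrict)).1 (by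
        ext x
        have h1 : (P.d (-1) 0).hom.rangeRestrict ((P.d (-2) (-1)).hom x) = 0 :=
          Subtype.ext ((hP.exact.exact_of_eq (-2) (-1) 0 rfl rfl).apply_apply_eq_zero x)
        change φ ((P.d (-1) 0).hom.rangeRestrict ((P.d (-2) (-1)).hom x)) = 0
        rw [h1, map_zero])
    refine ⟨ψ, ?_⟩
    ext z
    obtain ⟨y, rfl⟩ := hs'.surj z
    exact DFunLike.congr_fun hψ y
  · intro M _ _ hM
    rw [injective_iff_map_eq_zero]
    intro z hz
    -- A preimage of z in M ⊗ P⁻¹ is a cycle, hence comes from M ⊗ P⁻², which maps to zero in M ⊗ K.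
    obtain ⟨y, rfl⟩ := lTens_surjective M hs'.surj z
    rw [← lTens_comp] at hz
    obtain ⟨x, rfl⟩ := ((hM P hP).exact_of_eq (-2) (-1) 0 rfl rfl y).1 hz
    rw [← lTens_comp]
    have h1 : (P.d (-1) 0).hom.rangeRestrict ∘ₗ (P.d (-2) (-1)).hom = 0 := by
      ext x
      exact (hP.exact.exact_of_eq (-2) (-1) 0 rfl rfl).apply_apply_eq_zero x
    rw [h1, lTens_zero]

variable {K E : Type u} [AddCommGroup K] [Module R K] [AddCommGroup E] [Module R E]

/-- `Ext¹(G, W) = 0` for Gorenstein projective `G`, if `Hom(-, W)` preserves the exactness of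
complete projective resolutions. -/
theorem IsGorensteinProjective.exists_extension (h : IsGorensteinProjective R G)
    {i : K →ₗ[R] E} {p : E →ₗ[R] G} (hs : IsShortExact i p)
    {W : Type u} [AddCommGroup W] [Module R W]
    (hW : ∀ C : CochainComplex (ModuleCat.{u} R) ℤ, IsCompleteProjRes C → HomExact C W)
    (φ : K →ₗ[R] W) : ∃ ψ : E →ₗ[R] W, ψ ∘ₗ i = φ := by
  obtain ⟨P, L, j, q, hP, -, hjq, hext, -⟩ := h.exists_syzygy
  -- Compare with the syzygy sequence 0 → L → P → G → 0: the identity of G lifts to u : P → E, which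
  -- restricts to v : L → K. Then E is the quotient of P × K by the elements (-j l, v l).
  obtain ⟨u, hu⟩ := Module.projective_lifting_property p q hs.surj
  obtain ⟨v, hv⟩ := exists_lift hs.inj hs.exact (u ∘ₗ j) fun l =>
    (DFunLike.congr_fun hu (j l)).trans (hjq.exact.apply_apply_eq_zero l)
  replace hv : ∀ l, i (v l) = u (j l) := hv
  obtain ⟨χ, hχ⟩ := hext W hW (φ ∘ₗ v)
  let s : (P × K) →ₗ[R] E := u.coprod i
  have hsurj : Function.Surjective s := by
    intro x
    obtain ⟨y, hy⟩ := hjq.surj (p x)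
    obtain ⟨k, hk⟩ := (hs.exact (x - u y)).1 (by
      rw [map_sub, ← hy, sub_eq_zero]; exact (DFunLike.congr_fun hu y).symm)
    exact ⟨(y, k), by simp [s, hk]⟩
  -- On E, viewed as this pushout, ψ is glued from φ on K and an extension χ of φ ∘ v to P.
  obtain ⟨ψ, hψ⟩ := exists_desc (LinearMap.exact_subtype_ker_map s) hsurj (χ.coprod φ) (by
    rintro ⟨⟨y, k⟩, hyk⟩
    have hyk : u y + i k = 0 := by simpa [s] using hyk
    obtain ⟨l, rfl⟩ := (hjq.exact y).1 (by
      rw [← hu, LinearMap.comp_apply, eq_neg_of_add_eq_zero_left hyk, map_neg,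
        hs.exact.apply_apply_eq_zero, neg_zero])
    have h1 : v l + k = 0 := hs.inj (by rw [map_add, hv, hyk, map_zero])
    have h2 : χ (j l) = φ (v l) := DFunLike.congr_fun hχ l
    simp [h2, ← map_add, h1])
  refine ⟨ψ, ?_⟩
  ext k
  have h3 := hψ (0, k)
  simpa [s] using h3

/-- `Tor₁(M, G) = 0` for Gorenstein projective `G`, if `M ⊗ -` preserves the exactness of
complete projective resolutions. -/
theorem IsGorensteinProjective.lTens_injective (h : IsGorensteinProjective R G)
    {i : K →ₗ[R] E} {p : E →ₗ[R] G} (hs : IsShortExact i p)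
    {M : Type u} [AddCommGroup M] [Module Rᵐᵒᵖ M]
    (hM : ∀ C : CochainComplex (ModuleCat.{u} R) ℤ, IsCompleteProjRes C → TensExact M C) :
    Function.Injective (lTens R M i) := by
  obtain ⟨P, L, j, q, hP, -, hjq, -, htor⟩ := h.exists_syzygy
  obtain ⟨u, hu⟩ := Module.projective_lifting_property p q hs.surj
  obtain ⟨v, hv⟩ := exists_lift hs.inj hs.exact (u ∘ₗ j) fun l =>
    (DFunLike.congr_fun hu (j l)).trans (hjq.exact.apply_apply_eq_zero l)
  replace hv : ∀ l, i (v l) = u (j l) := hv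
  let s : (P × K) →ₗ[R] E := u.coprod i
  -- L → P × K → E → 0 is exact, so it stays exact after tensoring with M.
  let t : L →ₗ[R] (P × K) := (-j).prod v
  have hsurj : Function.Surjective s := by
    intro x
    obtain ⟨y, hy⟩ := hjq.surj (p x)
    obtain ⟨k, hk⟩ := (hs.exact (x - u y)).1 (by
      rw [map_sub, ← hy, sub_eq_zero]; exact (DFunLike.congr_fun hu y).symm)
    exact ⟨(y, k), by simp [s, hk]⟩
  have hts : Function.Exact t s := by
    rintro ⟨y, k⟩
    constructor
    · intro hyk
      have hyk : u y + i k = 0 := by simpa [s] using hyk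
      obtain ⟨l, rfl⟩ := (hjq.exact y).1 (by
        rw [← hu, LinearMap.comp_apply, eq_neg_of_add_eq_zero_left hyk, map_neg,
          hs.exact.apply_apply_eq_zero, neg_zero])
      refine ⟨-l, ?_⟩
      have h1 : v l + k = 0 := hs.inj (by rw [map_add, hv, hyk, map_zero])
      simp [t, eq_neg_of_add_eq_zero_left h1]
    · rintro ⟨l, hl⟩
      rw [← hl]
      simp [s, t, hv]
  rw [injective_iff_map_eq_zero]
  intro z hz
  have h1 : lTens R M s (lTens R M (LinearMap.inr R P K) z) = 0 := by
    rw [← lTens_comp]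
    simpa [s] using hz
  obtain ⟨w, hw⟩ := (lTens_exact M hts hsurj _).1 h1
  -- The element (0, z) comes from some w in M ⊗ L. Its P-coordinate says that w dies in M ⊗ P, so w
  -- = 0 by the Tor property of the syzygy; the K-coordinate then gives z = 0.
  have h2 := congrArg (lTens R M (-LinearMap.fst R P K)) hw
  rw [← lTens_comp, ← lTens_comp] at h2
  have h3 : (-LinearMap.fst R P K) ∘ₗ t = j := by ext; simp [t]
  have h4 : (-LinearMap.fst R P K) ∘ₗ LinearMap.inr R P K = 0 := by ext; simp
  rw [h3, h4, lTens_zero] at h2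
  have h5 : w = 0 := htor M hM (by rw [h2, map_zero])
  have h6 := congrArg (lTens R M (LinearMap.snd R P K)) hw
  rwa [h5, map_zero, map_zero, ← lTens_comp, LinearMap.snd_comp_inr, lTens_id, eq_comm] at h6

end GorensteinLemmas

/-- A quadruple `(X, Y, f, g)` with `g ∘ (1_M ⊗ f) = 0` and `f ∘ (1_N ⊗ g) = 0`. -/
structure Quad (A B M N : Type u) [Ring A] [Ring B]
    [AddCommGroup M] [Module A M] [Module Bᵐᵒᵖ M] [SMulCommClass A Bᵐᵒᵖ M]
    [AddCommGroup N] [Module B N] [Module Aᵐᵒᵖ N] [SMulCommClass B Aᵐᵒᵖ N] : Type (u + 1) where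
  X : Type u
  Y : Type u
  [addX : AddCommGroup X]
  [addY : AddCommGroup Y]
  [modX : Module A X]
  [modY : Module B Y]
  f : Tens A N X →ₗ[B] Y
  g : Tens B M Y →ₗ[A] X
  hgf : ∀ z, g (lTens B M f z) = 0
  hfg : ∀ z, f (lTens A N g z) = 0

attribute [instance] Quad.addX Quad.addY Quad.modX Quad.modY

section MoritaRingLemmas

variable {A B M N : Type u} [Ring A] [Ring B] [AddCommGroup M] [AddCommGroup N]

theorem MoritaRing.mk_add_mk (a a' : A) (b b' : B) (m m' : M) (n n' : N) :
    (⟨a, m, n, b⟩ : MoritaRing A B M N) + ⟨a', m', n', b'⟩ =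
      ⟨a + a', m + m', n + n', b + b'⟩ := rfl

theorem MoritaRing.mk_zero : (⟨0, 0, 0, 0⟩ : MoritaRing A B M N) = 0 := rfl

variable [Module A M] [Module Bᵐᵒᵖ M] [Module B N] [Module Aᵐᵒᵖ N]

theorem MoritaRing.mk_mul_mk (a a' : A) (b b' : B) (m m' : M) (n n' : N) :
    (⟨a, m, n, b⟩ : MoritaRing A B M N) * ⟨a', m', n', b'⟩ =
      ⟨a * a', a • m' + op b' • m, op a' • n + b • n', b * b'⟩ := rfl

end MoritaRingLemmas

/-! ### Quadruples as Λ-modules -/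

section QuadCategory

variable {A B M N : Type u} [Ring A] [Ring B]
  [AddCommGroup M] [Module A M] [Module Bᵐᵒᵖ M] [SMulCommClass A Bᵐᵒᵖ M]
  [AddCommGroup N] [Module B N] [Module Aᵐᵒᵖ N] [SMulCommClass B Aᵐᵒᵖ N]

namespace Quad

open MoritaRing

/-- The `Λ`-module of a quadruple. -/
abbrev mod (Z : Quad A B M N) : Type u := QuadMod Z.f Z.g Z.hgf Z.hfg

/-- The element `(x, y)` of the `Λ`-module of a quadruple. -/
def pt (Z : Quad A B M N) (x : Z.X) (y : Z.Y) : Z.mod := (x, y)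

theorem pt_add (Z : Quad A B M N) (x x' : Z.X) (y y' : Z.Y) :
    Z.pt x y + Z.pt x' y' = Z.pt (x + x') (y + y') := rfl

theorem smul_pt (Z : Quad A B M N) (l : MoritaRing A B M N) (x : Z.X) (y : Z.Y) :
    l • Z.pt x y = Z.pt (l.a • x + Z.g (tmul B l.m y)) (Z.f (tmul A l.n x) + l.b • y) := rfl

theorem pt_inj {Z : Quad A B M N} {x x' : Z.X} {y y' : Z.Y} :
    Z.pt x y = Z.pt x' y' ↔ x = x' ∧ y = y' := Prod.mk_inj

theorem pt_zero (Z : Quad A B M N) : Z.pt 0 0 = 0 := rfl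

/-- A morphism of quadruples. -/
structure Hom (Z Z' : Quad A B M N) where
  α : Z.X →ₗ[A] Z'.X
  β : Z.Y →ₗ[B] Z'.Y
  hf : ∀ n x, β (Z.f (tmul A n x)) = Z'.f (tmul A n (α x))
  hg : ∀ m y, α (Z.g (tmul B m y)) = Z'.g (tmul B m (β y))

variable {Z Z' Z'' : Quad A B M N}

theorem Hom.map_f (φ : Hom Z Z') (z : Tens A N Z.X) :
    φ.β (Z.f z) = Z'.f (lTens A N φ.α z) :=
  DFunLike.congr_fun (f := φ.β ∘ₗ Z.f) (g := Z'.f ∘ₗ lTensₗ B N φ.α) (tens_hom_ext' N φ.hf) z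

theorem Hom.map_g (φ : Hom Z Z') (z : Tens B M Z.Y) :
    φ.α (Z.g z) = Z'.g (lTens B M φ.β z) :=
  DFunLike.congr_fun (f := φ.α ∘ₗ Z.g) (g := Z'.g ∘ₗ lTensₗ A M φ.β) (tens_hom_ext' M φ.hg) z

/-- The `Λ`-linear map of a morphism of quadruples. -/
def Hom.toLin (φ : Hom Z Z') : Z.mod →ₗ[MoritaRing A B M N] Z'.mod where
  toFun z := Z'.pt (φ.α z.1) (φ.β z.2)
  map_add' z w := by
    rw [pt_add, ← map_add, ← map_add]; rfl
  map_smul' l z := by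
    change Z'.pt (φ.α (l.a • z.1 + Z.g (tmul B l.m z.2)))
      (φ.β (Z.f (tmul A l.n z.1) + l.b • z.2)) = l • Z'.pt (φ.α z.1) (φ.β z.2)
    rw [smul_pt, map_add, map_add, map_smul, map_smul, φ.hf, φ.hg]

theorem Hom.toLin_pt (φ : Hom Z Z') (x : Z.X) (y : Z.Y) :
    φ.toLin (Z.pt x y) = Z'.pt (φ.α x) (φ.β y) := rfl

theorem eq_pt (Z : Quad A B M N) (z : Z.mod) :
    z = Z.pt z.1 z.2 := rfl

theorem fst_pt (Z : Quad A B M N) (x : Z.X) (y : Z.Y) : (Z.pt x y).1 = x := rfl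

theorem snd_pt (Z : Quad A B M N) (x : Z.X) (y : Z.Y) : (Z.pt x y).2 = y := rfl

/-- Every `Λ`-linear map between modules of quadruples comes from a morphism of quadruples. -/
theorem exists_hom (φ : Z.mod →ₗ[MoritaRing A B M N] Z'.mod) : ∃ ψ : Hom Z Z', ψ.toLin = φ := by
  -- The diagonal idempotents are the projections onto the two coordinates. A Λ-linear map commutes
  -- with them, hence is diagonal.
  have hX : ∀ x, φ (Z.pt x 0) = Z'.pt (φ (Z.pt x 0)).1 0 := by
    intro x
    have h1 : Z.pt x 0 = (⟨1, 0, 0, 0⟩ : MoritaRing A B M N) • Z.pt x 0 := by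
      simp [smul_pt, zero_tmul]
    rw [h1, map_smul, eq_pt Z' (φ (Z.pt x 0)), smul_pt]
    simp [zero_tmul, fst_pt]
  have hY : ∀ y, φ (Z.pt 0 y) = Z'.pt 0 (φ (Z.pt 0 y)).2 := by
    intro y
    have h1 : Z.pt 0 y = (⟨0, 0, 0, 1⟩ : MoritaRing A B M N) • Z.pt 0 y := by
      simp [smul_pt, zero_tmul]
    rw [h1, map_smul, eq_pt Z' (φ (Z.pt 0 y)), smul_pt]
    simp [zero_tmul, snd_pt]
  let α : Z.X →ₗ[A] Z'.X :=
    { toFun := fun x => (φ (Z.pt x 0)).1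
      map_add' := fun x x' => by
        have h1 : Z.pt (x + x') 0 = Z.pt x 0 + Z.pt x' 0 := by rw [pt_add, add_zero]
        rw [h1, map_add]; rfl
      map_smul' := fun a x => by
        have h1 : Z.pt (a • x) 0 = (⟨a, 0, 0, 0⟩ : MoritaRing A B M N) • Z.pt x 0 := by
          simp [smul_pt, zero_tmul]
        rw [h1, map_smul, hX, smul_pt]
        simp [zero_tmul, fst_pt] }
  let β : Z.Y →ₗ[B] Z'.Y :=
    { toFun := fun y => (φ (Z.pt 0 y)).2
      map_add' := fun y y' => by
        have h1 : Z.pt 0 (y + y') = Z.pt 0 y + Z.pt 0 y' := by rw [pt_add, add_zero]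
        rw [h1, map_add]; rfl
      map_smul' := fun b y => by
        have h1 : Z.pt 0 (b • y) = (⟨0, 0, 0, b⟩ : MoritaRing A B M N) • Z.pt 0 y := by
          simp [smul_pt, zero_tmul]
        rw [h1, map_smul, hY, smul_pt]
        simp [zero_tmul, snd_pt] }
  -- The matrix with single entry n sends (x, 0) to (0, f (n ⊗ x)), so linearity over such matrices
  -- is compatibility with f; single entries m give compatibility with g.
  refine ⟨⟨α, β, fun n x => ?_, fun m y => ?_⟩, ?_⟩
  · change (φ (Z.pt 0 _)).2 = Z'.f (tmul A n (φ (Z.pt x 0)).1)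
    have h1 : Z.pt 0 (Z.f (tmul A n x)) = (⟨0, 0, n, 0⟩ : MoritaRing A B M N) • Z.pt x 0 := by
      simp [smul_pt, zero_tmul]
    rw [h1, map_smul, hX, smul_pt]
    simp [fst_pt, snd_pt]
  · change (φ (Z.pt _ 0)).1 = Z'.g (tmul B m (φ (Z.pt 0 y)).2)
    have h1 : Z.pt (Z.g (tmul B m y)) 0 = (⟨0, m, 0, 0⟩ : MoritaRing A B M N) • Z.pt 0 y := by
      simp [smul_pt, zero_tmul]
    rw [h1, map_smul, hY, smul_pt]
    simp [fst_pt, snd_pt]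
  · ext z
    have h1 : φ z = φ (Z.pt z.1 0) + φ (Z.pt 0 z.2) := by
      rw [← map_add, pt_add, add_zero, zero_add]; rfl
    conv_rhs => rw [h1, hX, hY, pt_add, add_zero, zero_add]
    rfl

/-! ### Short exact sequences of quadruples -/

theorem Hom.toLin_surjective {φ : Hom Z Z'} :
    Function.Surjective φ.toLin ↔ Function.Surjective φ.α ∧ Function.Surjective φ.β := by
  constructor
  · intro h
    refine ⟨fun x => ?_, fun y => ?_⟩
    · obtain ⟨z, hz⟩ := h (Z'.pt x 0)
      exact ⟨z.1, (pt_inj.1 hz).1⟩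
    · obtain ⟨z, hz⟩ := h (Z'.pt 0 y)
      exact ⟨z.2, (pt_inj.1 hz).2⟩
  · rintro ⟨h1, h2⟩ z
    obtain ⟨x, hx⟩ := h1 z.1
    obtain ⟨y, hy⟩ := h2 z.2
    exact ⟨Z.pt x y, pt_inj.2 ⟨hx, hy⟩⟩

theorem Hom.isShortExact_toLin {φ : Hom Z Z'} {ψ : Hom Z' Z''} :
    IsShortExact φ.toLin ψ.toLin ↔ IsShortExact φ.α ψ.α ∧ IsShortExact φ.β ψ.β := by
  constructor
  · intro h
    have hs := Hom.toLin_surjective.1 h.surj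
    refine ⟨⟨fun x x' hx => ?_, fun x => ⟨fun hx => ?_, ?_⟩, hs.1⟩,
      ⟨fun y y' hy => ?_, fun y => ⟨fun hy => ?_, ?_⟩, hs.2⟩⟩
    · have h1 : φ.toLin (Z.pt x 0) = φ.toLin (Z.pt x' 0) := pt_inj.2 ⟨hx, rfl⟩
      exact (pt_inj.1 (h.inj h1)).1
    · obtain ⟨z, hz⟩ := (h.exact (Z'.pt x 0)).1 (pt_inj.2 ⟨hx, map_zero _⟩)
      exact ⟨z.1, (pt_inj.1 hz).1⟩
    · rintro ⟨w, rfl⟩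
      exact (pt_inj.1 (h.exact.apply_apply_eq_zero (Z.pt w 0))).1
    · have h1 : φ.toLin (Z.pt 0 y) = φ.toLin (Z.pt 0 y') := pt_inj.2 ⟨rfl, hy⟩
      exact (pt_inj.1 (h.inj h1)).2
    · obtain ⟨z, hz⟩ := (h.exact (Z'.pt 0 y)).1 (pt_inj.2 ⟨map_zero _, hy⟩)
      exact ⟨z.2, (pt_inj.1 hz).2⟩
    · rintro ⟨w, rfl⟩
      exact (pt_inj.1 (h.exact.apply_apply_eq_zero (Z.pt 0 w))).2
  · rintro ⟨h1, h2⟩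
    refine ⟨fun z z' hz => ?_, fun z => ⟨fun hz => ?_, ?_⟩,
      Hom.toLin_surjective.2 ⟨h1.surj, h2.surj⟩⟩
    · exact pt_inj.2 ⟨h1.inj (pt_inj.1 hz).1, h2.inj (pt_inj.1 hz).2⟩
    · obtain ⟨x, hx⟩ := (h1.exact z.1).1 (pt_inj.1 hz).1
      obtain ⟨y, hy⟩ := (h2.exact z.2).1 (pt_inj.1 hz).2
      exact ⟨Z.pt x y, pt_inj.2 ⟨hx, hy⟩⟩
    · rintro ⟨w, rfl⟩
      exact pt_inj.2 ⟨h1.exact.apply_apply_eq_zero _, h2.exact.apply_apply_eq_zero _⟩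

/-! ### The quadruple of a `Λ`-module -/

variable {W : Type u} [AddCommGroup W] [Module (MoritaRing A B M N) W]

variable (A B M N W) in
/-- The `A`-module `e W` for the idempotent `e` with entry `1` in `A`. -/
def PartX : Type u := {w : W // (⟨1, 0, 0, 0⟩ : MoritaRing A B M N) • w = w}

variable (A B M N W) in
/-- The `B`-module `e W` for the idempotent `e` with entry `1` in `B`. -/
def PartY : Type u := {w : W // (⟨0, 0, 0, 1⟩ : MoritaRing A B M N) • w = w}

instance : AddCommGroup (PartX A B M N W) :=
  inferInstanceAs (AddCommGroup ((DistribSMul.toAddMonoidHom W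
    (⟨1, 0, 0, 0⟩ : MoritaRing A B M N)).eqLocus (AddMonoidHom.id W)))

instance : AddCommGroup (PartY A B M N W) :=
  inferInstanceAs (AddCommGroup ((DistribSMul.toAddMonoidHom W
    (⟨0, 0, 0, 1⟩ : MoritaRing A B M N)).eqLocus (AddMonoidHom.id W)))

instance : Module A (PartX A B M N W) where
  smul a w := ⟨(⟨a, 0, 0, 0⟩ : MoritaRing A B M N) • w.1, by
    rw [← mul_smul, mk_mul_mk]; simp⟩
  one_smul w := Subtype.ext w.2
  mul_smul a a' w := Subtype.ext (by
    change (⟨a * a', 0, 0, 0⟩ : MoritaRing A B M N) • w.1 =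
      (⟨a, 0, 0, 0⟩ : MoritaRing A B M N) • (⟨a', 0, 0, 0⟩ : MoritaRing A B M N) • w.1
    rw [← mul_smul, mk_mul_mk]; simp)
  smul_zero a := Subtype.ext (smul_zero _)
  smul_add a w w' := Subtype.ext (smul_add _ _ _)
  add_smul a a' w := Subtype.ext (by
    change (⟨a + a', 0, 0, 0⟩ : MoritaRing A B M N) • w.1 =
      (⟨a, 0, 0, 0⟩ : MoritaRing A B M N) • w.1 + (⟨a', 0, 0, 0⟩ : MoritaRing A B M N) • w.1
    rw [← add_smul, mk_add_mk]; simp)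
  zero_smul w := Subtype.ext (zero_smul _ _)

instance : Module B (PartY A B M N W) where
  smul b w := ⟨(⟨0, 0, 0, b⟩ : MoritaRing A B M N) • w.1, by
    rw [← mul_smul, mk_mul_mk]; simp⟩
  one_smul w := Subtype.ext w.2
  mul_smul b b' w := Subtype.ext (by
    change (⟨0, 0, 0, b * b'⟩ : MoritaRing A B M N) • w.1 =
      (⟨0, 0, 0, b⟩ : MoritaRing A B M N) • (⟨0, 0, 0, b'⟩ : MoritaRing A B M N) • w.1
    rw [← mul_smul, mk_mul_mk]; simp)
  smul_zero b := Subtype.ext (smul_zero _)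
  smul_add b w w' := Subtype.ext (smul_add _ _ _)
  add_smul b b' w := Subtype.ext (by
    change (⟨0, 0, 0, b + b'⟩ : MoritaRing A B M N) • w.1 =
      (⟨0, 0, 0, b⟩ : MoritaRing A B M N) • w.1 + (⟨0, 0, 0, b'⟩ : MoritaRing A B M N) • w.1
    rw [← add_smul, mk_add_mk]; simp)
  zero_smul w := Subtype.ext (zero_smul _ _)

theorem PartX.val_add (w w' : PartX A B M N W) : (w + w').1 = w.1 + w'.1 := rfl
theorem PartY.val_add (w w' : PartY A B M N W) : (w + w').1 = w.1 + w'.1 := rfl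
theorem PartX.val_smul (a : A) (w : PartX A B M N W) :
    (a • w).1 = (⟨a, 0, 0, 0⟩ : MoritaRing A B M N) • w.1 := rfl
theorem PartY.val_smul (b : B) (w : PartY A B M N W) :
    (b • w).1 = (⟨0, 0, 0, b⟩ : MoritaRing A B M N) • w.1 := rfl

variable (A B M N W) in
/-- The map `N ⊗_A X → Y`, `n ⊗ x ↦ n x`. -/
def partF : Tens A N (PartX A B M N W) →ₗ[B] PartY A B M N W :=
  let φ : Tens A N (PartX A B M N W) →+ PartY A B M N W := tensLift A
    (AddMonoidHom.mk' (fun n => AddMonoidHom.mk'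
        (fun w => ⟨(⟨0, 0, n, 0⟩ : MoritaRing A B M N) • w.1, by
          rw [← mul_smul, mk_mul_mk]; simp⟩)
        (fun w w' => Subtype.ext (smul_add _ _ _)))
      (fun n n' => by
        ext w
        refine Subtype.ext ?_
        change (⟨0, 0, n + n', 0⟩ : MoritaRing A B M N) • w.1 =
          (⟨0, 0, n, 0⟩ : MoritaRing A B M N) • w.1 + (⟨0, 0, n', 0⟩ : MoritaRing A B M N) • w.1
        rw [← add_smul, mk_add_mk]; simp))
    (fun n a w => Subtype.ext (by
      change (⟨0, 0, op a • n, 0⟩ : MoritaRing A B M N) • w.1 =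
        (⟨0, 0, n, 0⟩ : MoritaRing A B M N) • (⟨a, 0, 0, 0⟩ : MoritaRing A B M N) • w.1
      rw [← mul_smul, mk_mul_mk]; simp))
  { φ with
    map_smul' := fun b z => DFunLike.congr_fun (f := φ.comp (tensSMul A b))
      (g := (DistribSMul.toAddMonoidHom _ b).comp φ) (tens_hom_ext A fun n w => Subtype.ext (by
        change (⟨0, 0, b • n, 0⟩ : MoritaRing A B M N) • w.1 =
          (⟨0, 0, 0, b⟩ : MoritaRing A B M N) • (⟨0, 0, n, 0⟩ : MoritaRing A B M N) • w.1
        rw [← mul_smul, mk_mul_mk]; simp)) z }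

variable (A B M N W) in
/-- The map `M ⊗_B Y → X`, `m ⊗ y ↦ m y`. -/
def partG : Tens B M (PartY A B M N W) →ₗ[A] PartX A B M N W :=
  let φ : Tens B M (PartY A B M N W) →+ PartX A B M N W := tensLift B
    (AddMonoidHom.mk' (fun m => AddMonoidHom.mk'
        (fun w => ⟨(⟨0, m, 0, 0⟩ : MoritaRing A B M N) • w.1, by
          rw [← mul_smul, mk_mul_mk]; simp⟩)
        (fun w w' => Subtype.ext (smul_add _ _ _)))
      (fun m m' => by
        ext w
        refine Subtype.ext ?_
        change (⟨0, m + m', 0, 0⟩ : MoritaRing A B M N) • w.1 =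
          (⟨0, m, 0, 0⟩ : MoritaRing A B M N) • w.1 + (⟨0, m', 0, 0⟩ : MoritaRing A B M N) • w.1
        rw [← add_smul, mk_add_mk]; simp))
    (fun m b w => Subtype.ext (by
      change (⟨0, op b • m, 0, 0⟩ : MoritaRing A B M N) • w.1 =
        (⟨0, m, 0, 0⟩ : MoritaRing A B M N) • (⟨0, 0, 0, b⟩ : MoritaRing A B M N) • w.1
      rw [← mul_smul, mk_mul_mk]; simp))
  { φ with
    map_smul' := fun a z => DFunLike.congr_fun (f := φ.comp (tensSMul B a))
      (g := (DistribSMul.toAddMonoidHom _ a).comp φ) (tens_hom_ext B fun m w => Subtype.ext (by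
        change (⟨0, a • m, 0, 0⟩ : MoritaRing A B M N) • w.1 =
          (⟨a, 0, 0, 0⟩ : MoritaRing A B M N) • (⟨0, m, 0, 0⟩ : MoritaRing A B M N) • w.1
        rw [← mul_smul, mk_mul_mk]; simp)) z }

variable (A B M N W) in
/-- The quadruple of a `Λ`-module. -/
def ofModule : Quad A B M N where
  X := PartX A B M N W
  Y := PartY A B M N W
  f := partF A B M N W
  g := partG A B M N W
  hgf z := DFunLike.congr_fun
    (f := (partG A B M N W) ∘ₗ lTensₗ A M (partF A B M N W)) (g := 0)
    (tens_hom_ext' M fun m z => by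
      refine tens_induction A (p := fun z => partG A B M N W (tmul B m (partF A B M N W z)) = 0)
        ?_ ?_ ?_ z
      · rw [map_zero, tmul_zero, map_zero]
      · intro n w
        refine Subtype.ext ?_
        change (⟨0, m, 0, 0⟩ : MoritaRing A B M N) • (⟨0, 0, n, 0⟩ : MoritaRing A B M N) • w.1 = 0
        rw [← mul_smul, mk_mul_mk]
        simp [mk_zero]
      · intro z z' h h'
        rw [map_add, tmul_add, map_add, h, h', add_zero]) z
  hfg z := DFunLike.congr_fun
    (f := (partF A B M N W) ∘ₗ lTensₗ B N (partG A B M N W)) (g := 0)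
    (tens_hom_ext' N fun n z => by
      refine tens_induction B (p := fun z => partF A B M N W (tmul A n (partG A B M N W z)) = 0)
        ?_ ?_ ?_ z
      · rw [map_zero, tmul_zero, map_zero]
      · intro m w
        refine Subtype.ext ?_
        change (⟨0, 0, n, 0⟩ : MoritaRing A B M N) • (⟨0, m, 0, 0⟩ : MoritaRing A B M N) • w.1 = 0
        rw [← mul_smul, mk_mul_mk]
        simp [mk_zero]
      · intro z z' h h'
        rw [map_add, tmul_add, map_add, h, h', add_zero]) z

variable (A B M N W) in
/-- Every `Λ`-module is the module of its quadruple. -/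
noncomputable def ofModuleEquiv : (ofModule A B M N W).mod ≃ₗ[MoritaRing A B M N] W :=
  LinearEquiv.ofBijective
    { toFun := fun z => z.1.1 + z.2.1
      map_add' := fun z w => add_add_add_comm _ _ _ _
      map_smul' := fun l z => by
        obtain ⟨a, m, n, b⟩ := l
        obtain ⟨⟨x, hx⟩, ⟨y, hy⟩⟩ := z
        change ((⟨a, 0, 0, 0⟩ : MoritaRing A B M N) • x + (⟨0, m, 0, 0⟩ : MoritaRing A B M N) • y) +
          ((⟨0, 0, n, 0⟩ : MoritaRing A B M N) • x + (⟨0, 0, 0, b⟩ : MoritaRing A B M N) • y) =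
          (⟨a, m, n, b⟩ : MoritaRing A B M N) • (x + y)
        rw [add_add_add_comm, ← add_smul, ← add_smul, smul_add, mk_add_mk, mk_add_mk]
        -- Since x is fixed by the first idempotent, only the first column of a matrix acts on it;
        -- likewise y sees only the second column.
        congr 1
        · rw [← hx, ← mul_smul, ← mul_smul, mk_mul_mk, mk_mul_mk]
          simp
        · rw [← hy, ← mul_smul, ← mul_smul, mk_mul_mk, mk_mul_mk]
          simp }
    (by
      constructor
      · rw [injective_iff_map_eq_zero]
        rintro ⟨⟨x, hx⟩, ⟨y, hy⟩⟩ h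
        change x + y = 0 at h
        have h1 : (⟨1, 0, 0, 0⟩ : MoritaRing A B M N) • y = 0 := by
          rw [← hy, ← mul_smul, mk_mul_mk]
          simp [mk_zero]
        have h2 : x = 0 := by
          calc x = (⟨1, 0, 0, 0⟩ : MoritaRing A B M N) • x := hx.symm
            _ = (⟨1, 0, 0, 0⟩ : MoritaRing A B M N) • (x + y) := by rw [smul_add, h1, add_zero]
            _ = 0 := by rw [h, smul_zero]
        have h3 : y = 0 := by rwa [h2, zero_add] at h
        exact Prod.ext (Subtype.ext h2) (Subtype.ext h3)
      · intro w
        refine ⟨(⟨(⟨1, 0, 0, 0⟩ : MoritaRing A B M N) • w, ?_⟩,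
          ⟨(⟨0, 0, 0, 1⟩ : MoritaRing A B M N) • w, ?_⟩), ?_⟩
        · rw [← mul_smul, mk_mul_mk]; simp
        · rw [← mul_smul, mk_mul_mk]; simp
        · change (⟨1, 0, 0, 0⟩ : MoritaRing A B M N) • w + (⟨0, 0, 0, 1⟩ : MoritaRing A B M N) • w = w
          rw [← add_smul, mk_add_mk]
          simp only [add_zero, zero_add]
          exact one_smul (MoritaRing A B M N) w)

/-! ### Induced modules -/

variable (A B M N) in
/-- The quadruple of `Λ ⊗_{A × B} (V × V')`. -/
abbrev ind (V V' : Type u) [AddCommGroup V] [Module A V] [AddCommGroup V'] [Module B V'] :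
    Quad A B M N where
  X := V × Tens B M V'
  Y := V' × Tens A N V
  f := LinearMap.inr B V' (Tens A N V) ∘ₗ lTensₗ B N (LinearMap.fst A V (Tens B M V'))
  g := LinearMap.inr A V (Tens B M V') ∘ₗ lTensₗ A M (LinearMap.fst B V' (Tens A N V))
  hgf z := by
    have h : LinearMap.fst B V' (Tens A N V) ∘ₗ LinearMap.inr B V' (Tens A N V) ∘ₗ
      lTensₗ B N (LinearMap.fst A V (Tens B M V')) = 0 := by ext; simp
    rw [LinearMap.comp_apply, lTensₗ_apply, ← lTens_comp, h, lTens_zero, map_zero]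
  hfg z := by
    have h : LinearMap.fst A V (Tens B M V') ∘ₗ LinearMap.inr A V (Tens B M V') ∘ₗ
      lTensₗ A M (LinearMap.fst B V' (Tens A N V)) = 0 := by ext; simp
    rw [LinearMap.comp_apply, lTensₗ_apply, ← lTens_comp, h, lTens_zero, map_zero]

section Ind

variable {V V' : Type u} [AddCommGroup V] [Module A V] [AddCommGroup V'] [Module B V']

theorem ind_f (z : Tens A N (V × Tens B M V')) :
    (ind A B M N V V').f z = (0, lTens A N (LinearMap.fst A V (Tens B M V')) z) := rfl

theorem ind_g (z : Tens B M (V' × Tens A N V)) :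
    (ind A B M N V V').g z = (0, lTens B M (LinearMap.fst B V' (Tens A N V)) z) := rfl

/-- The morphism out of an induced module given by `V → X` and `V' → Y`. -/
def indLift (p : V →ₗ[A] Z.X) (q : V' →ₗ[B] Z.Y) : Hom (ind A B M N V V') Z where
  α := p.coprod (Z.g ∘ₗ lTensₗ A M q)
  β := q.coprod (Z.f ∘ₗ lTensₗ B N p)
  hf n x := by
    have h := Z.hfg (tmul A n (lTens B M q x.2))
    rw [lTens_tmul] at h
    rw [ind_f, lTens_tmul, LinearMap.coprod_apply, LinearMap.coprod_apply, tmul_add, map_add]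
    simp [h, lTens_tmul]
  hg m y := by
    have h := Z.hgf (tmul B m (lTens A N p y.2))
    rw [lTens_tmul] at h
    rw [ind_g, lTens_tmul, LinearMap.coprod_apply, LinearMap.coprod_apply, tmul_add, map_add]
    simp [h, lTens_tmul]

theorem indLift_α (p : V →ₗ[A] Z.X) (q : V' →ₗ[B] Z.Y) (x : V × Tens B M V') :
    (indLift p q).α x = p x.1 + Z.g (lTens B M q x.2) := rfl

theorem indLift_β (p : V →ₗ[A] Z.X) (q : V' →ₗ[B] Z.Y) (y : V' × Tens A N V) :
    (indLift p q).β y = q y.1 + Z.f (lTens A N p y.2) := rfl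

/-- The image of f is the summand N ⊗ V, so f has cokernel the projection to V'. Tensoring with M
gives the claim, as g is `1 ⊗ fst` followed by an injection. -/
theorem ind_exact_g : Function.Exact (lTens B M (ind A B M N V V').f) (ind A B M N V V').g := by
  have h : Function.Exact (ind A B M N V V').f (LinearMap.fst B V' (Tens A N V)) := by
    rintro ⟨v, w⟩
    constructor
    · rintro (rfl : v = 0)
      obtain ⟨z, rfl⟩ := lTens_surjective N
        (LinearMap.fst_surjective (R := A) (M := V) (M₂ := Tens B M V')) w
      exact ⟨z, rfl⟩
    · rintro ⟨z, hz⟩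
      rw [← hz]; rfl
  intro z
  rw [← lTens_exact M h LinearMap.fst_surjective z, ind_g, Prod.mk_eq_zero]
  simp

theorem ind_exact_f : Function.Exact (lTens A N (ind A B M N V V').g) (ind A B M N V V').f := by
  have h : Function.Exact (ind A B M N V V').g (LinearMap.fst A V (Tens B M V')) := by
    rintro ⟨v, w⟩
    constructor
    · rintro (rfl : v = 0)
      obtain ⟨z, rfl⟩ := lTens_surjective M
        (LinearMap.fst_surjective (R := B) (M := V') (M₂ := Tens A N V)) w
      exact ⟨z, rfl⟩
    · rintro ⟨z, hz⟩
      rw [← hz]; rfl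
  intro z
  rw [← lTens_exact N h LinearMap.fst_surjective z, ind_f, Prod.mk_eq_zero]
  simp

/-- Modules induced from projective modules are projective. -/
theorem projective_ind (hV : Module.Projective A V) (hV' : Module.Projective B V') :
    Module.Projective (MoritaRing A B M N) (ind A B M N V V').mod := by
  -- It is enough to split surjections from a free module, which is replaced by its quadruple.
  refine Module.Projective.of_lifting_property'' fun φ hφ => ?_
  let e := ofModuleEquiv A B M N ((ind A B M N V V').mod →₀ MoritaRing A B M N)
  obtain ⟨ψ, hψ⟩ := exists_hom (φ ∘ₗ e.toLinearMap)
  have hs := Hom.toLin_surjective.1 (show Function.Surjective ψ.toLin by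
    rw [hψ]; exact hφ.comp e.surjective)
  -- Morphisms out of an induced module are determined by V and V', so lifting their two inclusions
  -- produces a section.
  obtain ⟨p, hp⟩ := Module.projective_lifting_property ψ.α
    (LinearMap.inl A V (Tens B M V')) hs.1
  obtain ⟨q, hq⟩ := Module.projective_lifting_property ψ.β
    (LinearMap.inl B V' (Tens A N V)) hs.2
  refine ⟨e.toLinearMap ∘ₗ (indLift p q).toLin, ?_⟩
  rw [← LinearMap.comp_assoc, ← hψ]
  ext ⟨x, y⟩
  refine pt_inj.2 ⟨?_, ?_⟩
  · change ψ.α ((indLift p q).α x) = x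
    rw [indLift_α, map_add, ψ.map_g, ← LinearMap.comp_apply, hp, ← lTens_comp, hq, ind_g,
      ← lTens_comp, LinearMap.fst_comp_inl, lTens_id]
    simp
  · change ψ.β ((indLift p q).β y) = y
    rw [indLift_β, map_add, ψ.map_f, ← LinearMap.comp_apply, hq, ← lTens_comp, hp, ind_f,
      ← lTens_comp, LinearMap.fst_comp_inl, lTens_id]
    simp

end Ind

/-- A projective `Λ`-module is a direct summand of a module induced from projective modules. -/
theorem exists_retract (Z : Quad A B M N) (hZ : Module.Projective (MoritaRing A B M N) Z.mod) :
    ∃ (V V' : Type u) (_ : AddCommGroup V) (_ : Module A V) (_ : AddCommGroup V')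
      (_ : Module B V') (s : Hom Z (ind A B M N V V')) (r : Hom (ind A B M N V V') Z),
      Module.Projective A V ∧ Module.Projective B V' ∧
      (∀ x, r.α (s.α x) = x) ∧ (∀ y, r.β (s.β y) = y) := by
  let r : Hom (ind A B M N (Z.X →₀ A) (Z.Y →₀ B)) Z :=
    indLift (Finsupp.linearCombination A id) (Finsupp.linearCombination B id)
  have hr : Function.Surjective r.toLin := by
    refine Hom.toLin_surjective.2 ⟨fun x => ⟨(Finsupp.single x 1, 0), (indLift_α _ _ _).trans (by simp)⟩,
      fun y => ⟨(Finsupp.single y 1, 0), (indLift_β _ _ _).trans (by simp)⟩⟩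
  obtain ⟨σ, hσ⟩ := Module.projective_lifting_property r.toLin LinearMap.id hr
  obtain ⟨s, rfl⟩ := exists_hom σ
  exact ⟨_, _, _, _, _, _, s, r, inferInstance, inferInstance,
    fun x => (pt_inj.1 (DFunLike.congr_fun hσ (Z.pt x 0))).1,
    fun y => (pt_inj.1 (DFunLike.congr_fun hσ (Z.pt 0 y))).2⟩

/-- Exactness holds for induced modules and passes to retracts. -/
theorem exact_g_of_projective (Z : Quad A B M N)
    (hZ : Module.Projective (MoritaRing A B M N) Z.mod) :
    Function.Exact (lTens B M Z.f) Z.g := by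
  obtain ⟨V, V', _, _, _, _, s, r, -, -, hα, hβ⟩ := Z.exists_retract hZ
  intro z
  constructor
  · intro hz
    obtain ⟨w, hw⟩ := (ind_exact_g (lTens B M s.β z)).1 (by rw [← s.map_g, hz, map_zero])
    refine ⟨lTensₗ A M (lTensₗ B N r.α) w, ?_⟩
    have h1 : Z.f ∘ₗ lTensₗ B N r.α = r.β ∘ₗ (ind A B M N V V').f := by
      ext x; exact (r.map_f x).symm
    have h2 : r.β ∘ₗ s.β = LinearMap.id := LinearMap.ext hβ
    rw [lTensₗ_apply, ← lTens_comp, h1, lTens_comp, hw, ← lTens_comp, h2, lTens_id]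
  · rintro ⟨w, rfl⟩
    exact Z.hgf w

theorem exact_f_of_projective (Z : Quad A B M N)
    (hZ : Module.Projective (MoritaRing A B M N) Z.mod) :
    Function.Exact (lTens A N Z.g) Z.f := by
  obtain ⟨V, V', _, _, _, _, s, r, -, -, hα, hβ⟩ := Z.exists_retract hZ
  intro z
  constructor
  · intro hz
    obtain ⟨w, hw⟩ := (ind_exact_f (lTens A N s.α z)).1 (by rw [← s.map_f, hz, map_zero])
    refine ⟨lTensₗ B N (lTensₗ A M r.β) w, ?_⟩
    have h1 : Z.g ∘ₗ lTensₗ A M r.β = r.α ∘ₗ (ind A B M N V V').g := by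
      ext x; exact (r.map_g x).symm
    have h2 : r.α ∘ₗ s.α = LinearMap.id := LinearMap.ext hα
    rw [lTensₗ_apply, ← lTens_comp, h1, lTens_comp, hw, ← lTens_comp, h2, lTens_id]
  · rintro ⟨w, rfl⟩
    exact Z.hfg w

end Quad

end QuadCategory

/-! ### Embedding compatible quadruples into, and covering them by, induced modules -/

section QuadExact

variable {A B M N : Type u} [Ring A] [Ring B]
  [AddCommGroup M] [Module A M] [Module Bᵐᵒᵖ M] [SMulCommClass A Bᵐᵒᵖ M]
  [AddCommGroup N] [Module B N] [Module Aᵐᵒᵖ N] [SMulCommClass B Aᵐᵒᵖ N]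

namespace Quad

/-- The quadruple `(Y, X, g, f)` over the ring with `A` and `B` interchanged. -/
abbrev swap (Z : Quad A B M N) : Quad B A N M where
  X := Z.Y
  Y := Z.X
  f := Z.g
  g := Z.f
  hgf := Z.hfg
  hfg := Z.hgf

variable {Z Q Z' : Quad A B M N}

/-- The morphism `(β, α)` over the ring with `A` and `B` interchanged. -/
abbrev Hom.swap (φ : Hom Z Z') : Hom Z.swap Z'.swap where
  α := φ.β
  β := φ.α
  hf := φ.hg
  hg := φ.hf

/-- Right exactness of the tensor product gives the structure maps of the coordinatewise cokernel.
Their composites vanish because M ⊗ N ⊗ - and N ⊗ M ⊗ - preserve surjections. -/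
theorem exists_cokernel (φ : Hom Z Q) : ∃ (Z' : Quad A B M N) (ψ : Hom Q Z'),
    Function.Exact φ.α ψ.α ∧ Function.Surjective ψ.α ∧
    Function.Exact φ.β ψ.β ∧ Function.Surjective ψ.β := by
  let pX := (LinearMap.range φ.α).mkQ
  let pY := (LinearMap.range φ.β).mkQ
  have hX : Function.Exact φ.α pX := LinearMap.exact_map_mkQ_range _
  have hY : Function.Exact φ.β pY := LinearMap.exact_map_mkQ_range _
  have sX : Function.Surjective pX := Submodule.mkQ_surjective _
  have sY : Function.Surjective pY := Submodule.mkQ_surjective _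
  obtain ⟨f', hf'⟩ := exists_tens_desc N hX sX (pY ∘ₗ Q.f) (fun z => by
    rw [LinearMap.comp_apply, ← φ.map_f, hY.apply_apply_eq_zero])
  obtain ⟨g', hg'⟩ := exists_tens_desc M hY sY (pX ∘ₗ Q.g) (fun z => by
    rw [LinearMap.comp_apply, ← φ.map_g, hX.apply_apply_eq_zero])
  refine ⟨⟨_, _, f', g', fun z => ?_, fun z => ?_⟩,
    ⟨pX, pY, fun n x => (hf' (tmul A n x)).symm, fun m y => (hg' (tmul B m y)).symm⟩, hX, sX, hY, sY⟩
  · obtain ⟨w, rfl⟩ := lTens_surjective M (h := lTensₗ B N pX) (lTens_surjective N sX) z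
    have h : f' ∘ₗ lTensₗ B N pX = pY ∘ₗ Q.f := LinearMap.ext hf'
    rw [← lTens_comp, h, lTens_comp, hg', LinearMap.comp_apply, Q.hgf, map_zero]
  · obtain ⟨w, rfl⟩ := lTens_surjective N (h := lTensₗ A M pY) (lTens_surjective M sY) z
    have h : g' ∘ₗ lTensₗ A M pY = pX ∘ₗ Q.g := LinearMap.ext hg'
    rw [← lTens_comp, h, lTens_comp, hf', LinearMap.comp_apply, Q.hfg, map_zero]

/-- The structure maps of Q restrict to the coordinatewise kernels, and their relations can be
checked in Q. -/
theorem exists_kernel (ψ : Hom Q Z') : ∃ (Z : Quad A B M N) (φ : Hom Z Q),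
    Function.Exact φ.α ψ.α ∧ Function.Injective φ.α ∧
    Function.Exact φ.β ψ.β ∧ Function.Injective φ.β := by
  let iX := (LinearMap.ker ψ.α).subtype
  let iY := (LinearMap.ker ψ.β).subtype
  have hX : Function.Exact iX ψ.α := LinearMap.exact_subtype_ker_map _
  have hY : Function.Exact iY ψ.β := LinearMap.exact_subtype_ker_map _
  have sX : Function.Injective iX := Subtype.val_injective
  have sY : Function.Injective iY := Subtype.val_injective
  obtain ⟨f', hf'⟩ := exists_lift sY hY (Q.f ∘ₗ lTensₗ B N iX) (fun z => by
    rw [LinearMap.comp_apply, lTensₗ_apply, ψ.map_f, ← lTens_comp, hX.linearMap_comp_eq_zero,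
      lTens_zero, map_zero])
  obtain ⟨g', hg'⟩ := exists_lift sX hX (Q.g ∘ₗ lTensₗ A M iY) (fun z => by
    rw [LinearMap.comp_apply, lTensₗ_apply, ψ.map_g, ← lTens_comp, hY.linearMap_comp_eq_zero,
      lTens_zero, map_zero])
  refine ⟨⟨_, _, f', g', fun z => sX ?_, fun z => sY ?_⟩,
    ⟨iX, iY, fun n x => hf' (tmul A n x), fun m y => hg' (tmul B m y)⟩, hX, sX, hY, sY⟩
  · have h : iY ∘ₗ f' = Q.f ∘ₗ lTensₗ B N iX := LinearMap.ext hf'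
    rw [hg', LinearMap.comp_apply, lTensₗ_apply, ← lTens_comp, h, lTens_comp, Q.hgf, map_zero]
  · have h : iX ∘ₗ g' = Q.g ∘ₗ lTensₗ A M iY := LinearMap.ext hg'
    rw [hf', LinearMap.comp_apply, lTensₗ_apply, ← lTens_comp, h, lTens_comp, Q.hfg, map_zero]

/-- The cokernels of `f` and `g` are Gorenstein projective and the sequences
`M ⊗ N ⊗ X → M ⊗ Y → X` and `N ⊗ M ⊗ Y → N ⊗ X → Y` are exact. -/
structure IsCompatible (Z : Quad A B M N) : Prop where
  cokerX : ∃ (G : ModuleCat.{u} A) (c : Z.X →ₗ[A] G), IsGorensteinProjective A G ∧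
    Function.Exact Z.g c ∧ Function.Surjective c
  cokerY : ∃ (G : ModuleCat.{u} B) (c : Z.Y →ₗ[B] G), IsGorensteinProjective B G ∧
    Function.Exact Z.f c ∧ Function.Surjective c
  exact_g : Function.Exact (lTens B M Z.f) Z.g
  exact_f : Function.Exact (lTens A N Z.g) Z.f

variable {GA GA' P V : Type u} [AddCommGroup GA] [Module A GA] [AddCommGroup GA'] [Module A GA']
  [AddCommGroup P] [Module A P] [AddCommGroup V] [Module A V]
  {GB GB' P' V' : Type u} [AddCommGroup GB] [Module B GB] [AddCommGroup GB'] [Module B GB']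
  [AddCommGroup P'] [Module B P'] [AddCommGroup V'] [Module B V']

/-! ### Embedding into an induced module -/

/-- By `hg`, the map induced by g makes 0 → M ⊗ Coker f → X → Coker g → 0 exact; the extension of φ
to X exists because Ext¹(Coker g, W) = 0. -/
theorem exists_twist {cX : Z.X →ₗ[A] GA} (hcX : Function.Exact Z.g cX)
    (sX : Function.Surjective cX) {cY : Z.Y →ₗ[B] GB} (hcY : Function.Exact Z.f cY)
    (sY : Function.Surjective cY) (hg : Function.Exact (lTens B M Z.f) Z.g)
    (hGA : IsGorensteinProjective A GA) {W : Type u} [AddCommGroup W] [Module A W]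
    (hW : ∀ C : CochainComplex (ModuleCat.{u} A) ℤ, IsCompleteProjRes C → HomExact C W)
    (φ : Tens B M GB →ₗ[A] W) :
    ∃ ψ : Z.X →ₗ[A] W, ∀ z, ψ (Z.g z) = φ (lTens B M cY z) := by
  obtain ⟨γ, hγ⟩ := exists_tens_desc M hcY sY Z.g Z.hgf
  have hs : IsShortExact γ cX := by
    refine ⟨?_, fun x => ?_, sX⟩
    · rw [injective_iff_map_eq_zero]
      intro z hz
      obtain ⟨w, rfl⟩ := lTens_surjective M sY z
      rw [hγ] at hz
      exact (lTens_exact M hcY sY w).2 ((hg w).1 hz)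
    · rw [hcX x]
      constructor
      · rintro ⟨z, rfl⟩
        exact ⟨_, hγ z⟩
      · rintro ⟨z, rfl⟩
        obtain ⟨w, rfl⟩ := lTens_surjective M sY z
        exact ⟨w, (hγ w).symm⟩
  obtain ⟨ψ, hψ⟩ := hGA.exists_extension hs hW φ
  exact ⟨ψ, fun z => by rw [← hγ, ← hψ, LinearMap.comp_apply]⟩

/-- If the first coordinate of the image of x vanishes, then x = g z. The second then shows that z
dies in M ⊗ Coker f, so z comes from `1 ⊗ f`, which g kills. -/
theorem embedding_injective {cX : Z.X →ₗ[A] GA} (hcX : Function.Exact Z.g cX)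
    {cY : Z.Y →ₗ[B] GB} (hcY : Function.Exact Z.f cY)
    (sY : Function.Surjective cY) (hg : Function.Exact (lTens B M Z.f) Z.g)
    {iA : GA →ₗ[A] P} (hiA : Function.Injective iA) {iB : GB →ₗ[B] P'}
    (hiB : Function.Injective (lTens B M iB)) {ψ : Z.X →ₗ[A] Tens B M P'}
    (hψ : ∀ z, ψ (Z.g z) = lTens B M iB (lTens B M cY z)) :
    Function.Injective ((iA ∘ₗ cX).prod ψ) := by
  rw [injective_iff_map_eq_zero]
  intro x hx
  obtain ⟨h1, h2⟩ := Prod.mk_eq_zero.1 hx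
  obtain ⟨z, rfl⟩ := (hcX x).1 (hiA (by rw [map_zero]; exact h1))
  change ψ _ = 0 at h2
  rw [hψ] at h2
  exact (hg z).2 ((lTens_exact M hcY sY z).1 (hiB (by rw [h2, map_zero])))

/-- Passing to cokernels of g turns the sequence Z → ind → Z' into Coker g → P → GA'. For exactness,
an element whose P-coordinate lies in the image of `iA` can be corrected by Z to have zero
P-coordinate, and then it lies in the image of g. -/
theorem exists_coker_of_cosyzygy {φ : Hom Z (ind A B M N P P')} {ψ : Hom (ind A B M N P P') Z'}
    (eα : Function.Exact φ.α ψ.α) (sα : Function.Surjective ψ.α) (sβ : Function.Surjective ψ.β)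
    {cX : Z.X →ₗ[A] GA} (scX : Function.Surjective cX)
    {iA : GA →ₗ[A] P} {pA : P →ₗ[A] GA'} (hA : IsShortExact iA pA)
    (hφ : ∀ x, (φ.α x).1 = iA (cX x)) :
    ∃ c : Z'.X →ₗ[A] GA', Function.Exact Z'.g c ∧ Function.Surjective c := by
  obtain ⟨c, hc⟩ := exists_desc eα sα (pA ∘ₗ LinearMap.fst A P (Tens B M P')) (fun x => by
    change pA (φ.α x).1 = 0
    rw [hφ, hA.exact.apply_apply_eq_zero])
  refine ⟨c, fun x' => ⟨fun hx' => ?_, ?_⟩, fun v => ?_⟩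
  · obtain ⟨x, rfl⟩ := sα x'
    rw [hc] at hx'
    obtain ⟨a, ha⟩ := (hA.exact x.1).1 hx'
    obtain ⟨z, rfl⟩ := scX a
    obtain ⟨t, ht⟩ := lTens_surjective M
      (LinearMap.fst_surjective (R := B) (M := P') (M₂ := Tens A N P)) (x - φ.α z).2
    refine ⟨lTens B M ψ.β t, ?_⟩
    rw [← ψ.map_g, ind_g, ht]
    have h1 : ((0 : P), (x - φ.α z).2) = x - φ.α z := by
      refine Prod.ext ?_ rfl
      change 0 = x.1 - (φ.α z).1
      rw [hφ, ha, sub_self]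
    rw [h1, map_sub, eα.apply_apply_eq_zero, sub_zero]
  · rintro ⟨z', rfl⟩
    obtain ⟨t, rfl⟩ := lTens_surjective M sβ z'
    rw [← ψ.map_g, hc, ind_g]
    simp
  · obtain ⟨p, rfl⟩ := hA.surj v
    exact ⟨ψ.α (p, 0), hc _⟩

/-- Lift t' to s. Then g s comes from some x in Z, and x lies in the image of g because g s has zero
P-coordinate and `iA` is injective. Correcting s by Z puts it in the kernel of g, where exactness
for the induced module applies. -/
theorem exact_g_of_cosyzygy {φ : Hom Z (ind A B M N P P')} {ψ : Hom (ind A B M N P P') Z'}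
    (eα : Function.Exact φ.α ψ.α) (eβ : Function.Exact φ.β ψ.β)
    (sβ : Function.Surjective ψ.β)
    {cX : Z.X →ₗ[A] GA} (hcX : Function.Exact Z.g cX)
    {iA : GA →ₗ[A] P} (hiA : Function.Injective iA)
    (hφ : ∀ x, (φ.α x).1 = iA (cX x)) :
    Function.Exact (lTens B M Z'.f) Z'.g := by
  intro t'
  constructor
  · intro ht'
    obtain ⟨s, rfl⟩ := lTens_surjective M sβ t'
    rw [← ψ.map_g] at ht'
    obtain ⟨x, hx⟩ := (eα _).1 ht'
    obtain ⟨r, rfl⟩ := (hcX x).1 (hiA (by rw [← hφ, hx, ind_g, map_zero]))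
    rw [φ.map_g, ← sub_eq_zero, ← map_sub] at hx
    obtain ⟨u, hu⟩ := (ind_exact_g _).1 hx
    refine ⟨-lTensₗ A M (lTensₗ B N ψ.α) u, ?_⟩
    have h1 : Z'.f ∘ₗ lTensₗ B N ψ.α = ψ.β ∘ₗ (ind A B M N P P').f := by
      ext x; exact (ψ.map_f x).symm
    rw [map_neg, lTensₗ_apply, ← lTens_comp, h1, lTens_comp, hu, map_sub, ← lTens_comp M ψ.β φ.β,
      eβ.linearMap_comp_eq_zero, lTens_zero, zero_sub, neg_neg]
  · rintro ⟨w, rfl⟩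
    exact Z'.hgf w

/-! ### Covering by an induced module -/

/-- The value g t depends only on the class of t in M ⊗ Coker f, onto which M ⊗ P' already surjects.
-/
theorem exists_lTens_of_cover {cY : Z'.Y →ₗ[B] GB} (hcY : Function.Exact Z'.f cY)
    (sY : Function.Surjective cY) {γ : P' →ₗ[B] Z'.Y} {q : P' →ₗ[B] GB}
    (hq : Function.Surjective q) (hγ : ∀ p, cY (γ p) = q p) (t : Tens B M Z'.Y) :
    ∃ w, Z'.g (lTens B M γ w) = Z'.g t := by
  obtain ⟨w, hw⟩ := lTens_surjective M hq (lTens B M cY t)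
  refine ⟨w, ?_⟩
  have h1 : cY ∘ₗ γ = q := LinearMap.ext hγ
  obtain ⟨u, hu⟩ := (lTens_exact M hcY sY (lTens B M γ w - t)).1 (by
    rw [map_sub, ← lTens_comp, h1, hw, sub_self])
  rw [← sub_eq_zero, ← map_sub, ← hu, Z'.hgf]

theorem cover_surjective {cX : Z'.X →ₗ[A] GA} (hcX : Function.Exact Z'.g cX)
    {cY : Z'.Y →ₗ[B] GB} (hcY : Function.Exact Z'.f cY)
    (sY : Function.Surjective cY) {γA : P →ₗ[A] Z'.X} {qA : P →ₗ[A] GA}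
    (sqA : Function.Surjective qA) (hγA : ∀ p, cX (γA p) = qA p)
    {γB : P' →ₗ[B] Z'.Y} {qB : P' →ₗ[B] GB} (sqB : Function.Surjective qB)
    (hγB : ∀ p, cY (γB p) = qB p) :
    Function.Surjective (indLift (Z := Z') γA γB).α := by
  intro x
  obtain ⟨p, hp⟩ := sqA (cX x)
  obtain ⟨t, ht⟩ := (hcX (x - γA p)).1 (by rw [map_sub, hγA, hp, sub_self])
  obtain ⟨w, hw⟩ := exists_lTens_of_cover hcY sY sqB hγB t
  exact ⟨(p, w), by rw [indLift_α, hw, ht, add_sub_cancel]⟩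

/-- The P-coordinate of a kernel element dies in Coker g, hence lies in GA'. Conversely, for k in
GA' the element `γA (jA k)` lies in the image of g and can be cancelled by an element of M ⊗ P'. -/
theorem exists_coker_of_syzygy {γA : P →ₗ[A] Z'.X} {γB : P' →ₗ[B] Z'.Y}
    {φ : Hom Z (ind A B M N P P')} (eα : Function.Exact φ.α (indLift (Z := Z') γA γB).α)
    {cX : Z'.X →ₗ[A] GA} (hcX : Function.Exact Z'.g cX)
    {cY : Z'.Y →ₗ[B] GB} (hcY : Function.Exact Z'.f cY) (sY : Function.Surjective cY)
    {jA : GA' →ₗ[A] P} {qA : P →ₗ[A] GA} (hA : IsShortExact jA qA)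
    (hγA : ∀ p, cX (γA p) = qA p) {qB : P' →ₗ[B] GB} (sqB : Function.Surjective qB)
    (hγB : ∀ p, cY (γB p) = qB p) :
    ∃ c : Z.X →ₗ[A] GA', Function.Surjective c ∧ ∀ x, jA (c x) = (φ.α x).1 := by
  obtain ⟨c, hc⟩ := exists_lift hA.inj hA.exact (LinearMap.fst A P (Tens B M P') ∘ₗ φ.α) (by
    intro x
    have h1 := congrArg cX (eα.apply_apply_eq_zero x)
    rw [indLift_α, map_add, hcX.apply_apply_eq_zero, add_zero, map_zero, hγA] at h1
    exact h1)
  refine ⟨c, fun k => ?_, hc⟩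
  obtain ⟨t, ht⟩ := (hcX (γA (jA k))).1 (by rw [hγA, hA.exact.apply_apply_eq_zero])
  obtain ⟨w, hw⟩ := exists_lTens_of_cover hcY sY sqB hγB t
  obtain ⟨x, hx⟩ := (eα (jA k, -w)).1 (by
    rw [indLift_α, map_neg, map_neg, hw, ht, add_neg_cancel])
  exact ⟨x, hA.inj (by rw [hc, LinearMap.comp_apply, hx]; rfl)⟩

/-- A kernel element with zero P-coordinate has M ⊗ P'-coordinate that dies in M ⊗ Coker f, by `hg`.
So it comes from M ⊗ GB', hence from M ⊗ Z.Y since `d` is surjective. -/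
theorem exact_coker_of_syzygy {γA : P →ₗ[A] Z'.X} {γB : P' →ₗ[B] Z'.Y}
    {φ : Hom Z (ind A B M N P P')} (eα : Function.Exact φ.α (indLift (Z := Z') γA γB).α)
    (iα : Function.Injective φ.α) (hg : Function.Exact (lTens B M Z'.f) Z'.g)
    {cY : Z'.Y →ₗ[B] GB} (hcY : Function.Exact Z'.f cY) (sY : Function.Surjective cY)
    {jA : GA' →ₗ[A] P} (hjA : Function.Injective jA)
    {jB : GB' →ₗ[B] P'} {qB : P' →ₗ[B] GB} (hB : IsShortExact jB qB)
    (hγB : ∀ p, cY (γB p) = qB p)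
    {c : Z.X →ₗ[A] GA'} (hc : ∀ x, jA (c x) = (φ.α x).1)
    {d : Z.Y →ₗ[B] GB'} (sd : Function.Surjective d) (hd : ∀ y, jB (d y) = (φ.β y).1) :
    Function.Exact Z.g c := by
  have hd' : LinearMap.fst B P' (Tens A N P) ∘ₗ φ.β = jB ∘ₗ d :=
    LinearMap.ext fun y => (hd y).symm
  intro x
  constructor
  · intro hx
    have h1 : (φ.α x).1 = 0 := by rw [← hc, hx, map_zero]
    have h2 := eα.apply_apply_eq_zero x
    rw [indLift_α, h1, map_zero, zero_add] at h2
    have h3 := (lTens_exact M hcY sY _).2 ((hg _).1 h2)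
    rw [← lTens_comp, show cY ∘ₗ γB = qB from LinearMap.ext hγB] at h3
    obtain ⟨u, hu⟩ := (lTens_exact M hB.exact hB.surj _).1 h3
    obtain ⟨t, rfl⟩ := lTens_surjective M sd u
    refine ⟨t, iα ?_⟩
    rw [φ.map_g, ind_g, ← lTens_comp, hd', lTens_comp, hu, ← h1]
  · rintro ⟨t, rfl⟩
    refine hjA ?_
    rw [hc, φ.map_g, ind_g, map_zero]

/-- Inside the induced module, g t becomes the image of t under M ⊗ Z.Y → M ⊗ GB' → M ⊗ P'. The
second map is injective and the first has kernel the image of `1 ⊗ f`. -/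
theorem exact_g_of_syzygy {φ : Hom Z (ind A B M N P P')} {jB : GB' →ₗ[B] P'}
    (hjB : Function.Injective (lTens B M jB)) {d : Z.Y →ₗ[B] GB'}
    (sd : Function.Surjective d) (ed : Function.Exact Z.f d)
    (hd : ∀ y, jB (d y) = (φ.β y).1) : Function.Exact (lTens B M Z.f) Z.g := by
  have hd' : LinearMap.fst B P' (Tens A N P) ∘ₗ φ.β = jB ∘ₗ d :=
    LinearMap.ext fun y => (hd y).symm
  intro t
  constructor
  · intro ht
    have h1 := φ.map_g t
    rw [ht, map_zero, ind_g, ← lTens_comp, hd', lTens_comp] at h1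
    have h2 := (Prod.mk_eq_zero.1 h1.symm).2
    exact (lTens_exact M ed sd t).1 (hjB (by rw [h2, map_zero]))
  · rintro ⟨w, rfl⟩
    exact Z.hgf w

/-! ### Extension of maps into induced modules -/

/-- The V-coordinate of χ vanishes on the image of g, so it is a map on Coker g, which extends to P.
-/
theorem exists_fst_extension {cX : Z.X →ₗ[A] GA} (hcX : Function.Exact Z.g cX)
    (sX : Function.Surjective cX) {iA : GA →ₗ[A] P}
    (hext : ∀ φ : GA →ₗ[A] V, ∃ ψ : P →ₗ[A] V, ψ ∘ₗ iA = φ)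
    {φ : Hom Z (ind A B M N P P')} (hφ : ∀ x, (φ.α x).1 = iA (cX x))
    (χ : Hom Z (ind A B M N V V')) : ∃ p : P →ₗ[A] V, ∀ x, p (φ.α x).1 = (χ.α x).1 := by
  obtain ⟨χ', hχ'⟩ := exists_desc hcX sX (LinearMap.fst A V (Tens B M V') ∘ₗ χ.α) (by
    intro z
    rw [LinearMap.comp_apply, χ.map_g, ind_g]
    rfl)
  obtain ⟨p, hp⟩ := hext χ'
  exact ⟨p, fun x => by rw [hφ, ← LinearMap.comp_apply, hp, hχ']; rfl⟩

/-- The M ⊗ V'-coordinate of χ need not kill the image of g, but subtracting the contribution of the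
already chosen `q` makes it do so. The difference is a map on Coker g and extends to P. -/
theorem exists_snd_extension {cX : Z.X →ₗ[A] GA} (hcX : Function.Exact Z.g cX)
    (sX : Function.Surjective cX) {iA : GA →ₗ[A] P}
    (hext : ∀ φ : GA →ₗ[A] Tens B M V', ∃ ψ : P →ₗ[A] Tens B M V', ψ ∘ₗ iA = φ)
    {φ : Hom Z (ind A B M N P P')} (hφ : ∀ x, (φ.α x).1 = iA (cX x))
    (χ : Hom Z (ind A B M N V V')) {q : P' →ₗ[B] V'} (hq : ∀ y, q (φ.β y).1 = (χ.β y).1) :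
    ∃ p : P →ₗ[A] Tens B M V', ∀ x, p (φ.α x).1 + lTens B M q (φ.α x).2 = (χ.α x).2 := by
  have hq' : (q ∘ₗ LinearMap.fst B P' (Tens A N P)) ∘ₗ φ.β =
    LinearMap.fst B V' (Tens A N V) ∘ₗ χ.β := LinearMap.ext hq
  obtain ⟨χ', hχ'⟩ := exists_desc hcX sX (LinearMap.snd A V (Tens B M V') ∘ₗ χ.α -
      lTensₗ A M q ∘ₗ LinearMap.snd A P (Tens B M P') ∘ₗ φ.α) (by
    intro z
    rw [LinearMap.sub_apply, LinearMap.comp_apply, LinearMap.comp_apply, LinearMap.comp_apply,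
      χ.map_g, φ.map_g, ind_g, ind_g, LinearMap.snd_apply, LinearMap.snd_apply, lTensₗ_apply,
      ← lTens_comp, ← lTens_comp, ← lTens_comp, hq']
    exact sub_self _)
  obtain ⟨p, hp⟩ := hext χ'
  refine ⟨p, fun x => ?_⟩
  rw [hφ, ← LinearMap.comp_apply, hp, hχ']
  exact sub_add_cancel _ _

/-- A morphism between induced modules amounts to maps P → V ⊕ M ⊗ V' and P' → V' ⊕ N ⊗ V. The
components into V and V' must be chosen first, since the correction for the other two involves them.
-/
theorem exists_hom_extension {cX : Z.X →ₗ[A] GA} (hcX : Function.Exact Z.g cX)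
    (sX : Function.Surjective cX) {cY : Z.Y →ₗ[B] GB} (hcY : Function.Exact Z.f cY)
    (sY : Function.Surjective cY) {iA : GA →ₗ[A] P} {iB : GB →ₗ[B] P'}
    (hextA : ∀ φ : GA →ₗ[A] V, ∃ ψ : P →ₗ[A] V, ψ ∘ₗ iA = φ)
    (hextA' : ∀ φ : GA →ₗ[A] Tens B M V', ∃ ψ : P →ₗ[A] Tens B M V', ψ ∘ₗ iA = φ)
    (hextB : ∀ φ : GB →ₗ[B] V', ∃ ψ : P' →ₗ[B] V', ψ ∘ₗ iB = φ)
    (hextB' : ∀ φ : GB →ₗ[B] Tens A N V, ∃ ψ : P' →ₗ[B] Tens A N V, ψ ∘ₗ iB = φ)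
    {φ : Hom Z (ind A B M N P P')} (hφX : ∀ x, (φ.α x).1 = iA (cX x))
    (hφY : ∀ y, (φ.β y).1 = iB (cY y)) (χ : Hom Z (ind A B M N V V')) :
    ∃ ψ : Hom (ind A B M N P P') (ind A B M N V V'),
      (∀ x, ψ.α (φ.α x) = χ.α x) ∧ (∀ y, ψ.β (φ.β y) = χ.β y) := by
  obtain ⟨p, hp⟩ := exists_fst_extension hcX sX hextA hφX χ
  obtain ⟨q, hq⟩ := exists_fst_extension (Z := Z.swap) (φ := φ.swap) hcY sY hextB hφY χ.swap
  obtain ⟨p', hp'⟩ := exists_snd_extension hcX sX hextA' hφX χ hq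
  obtain ⟨q', hq'⟩ := exists_snd_extension (Z := Z.swap) (φ := φ.swap) hcY sY hextB' hφY χ.swap hp
  refine ⟨indLift (p.prod p') (q.prod q'), fun x => ?_, fun y => ?_⟩
  · rw [indLift_α, ind_g, ← lTens_comp, LinearMap.fst_prod]
    refine Prod.ext ?_ (hp' x)
    exact (add_zero _).trans (hp x)
  · rw [indLift_β, ind_f, ← lTens_comp, LinearMap.fst_prod]
    refine Prod.ext ?_ (hq' y)
    exact (add_zero _).trans (hq y)

end Quad

end QuadExact

/-! ### Compatible quadruples are Gorenstein projective -/

section Characterization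

variable {A B M N : Type u} [Ring A] [Ring B]
  [AddCommGroup M] [Module A M] [Module Bᵐᵒᵖ M] [SMulCommClass A Bᵐᵒᵖ M]
  [AddCommGroup N] [Module B N] [Module Aᵐᵒᵖ N] [SMulCommClass B Aᵐᵒᵖ N]

namespace Quad

/-- A short exact sequence `0 → Z → Q → Z' → 0` with `Q` induced from projective modules stays
exact under `Hom(-, W)` for all projective `W` if it does for all induced projective `W`. -/
theorem projStep_of_isShortExact {Z Z' : Quad A B M N} {P P' : Type u} [AddCommGroup P] [Module A P]
    [AddCommGroup P'] [Module B P'] (hP : Module.Projective A P) (hP' : Module.Projective B P')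
    {φ : Hom Z (ind A B M N P P')} {ψ : Hom (ind A B M N P P') Z'}
    (hα : IsShortExact φ.α ψ.α) (hβ : IsShortExact φ.β ψ.β)
    (hext : ∀ (V V' : Type u) [AddCommGroup V] [Module A V] [AddCommGroup V'] [Module B V'],
      Module.Projective A V → Module.Projective B V' → ∀ χ : Hom Z (ind A B M N V V'),
      ∃ σ : Hom (ind A B M N P P') (ind A B M N V V'),
        (∀ x, σ.α (φ.α x) = χ.α x) ∧ (∀ y, σ.β (φ.β y) = χ.β y)) :
    ProjStep (ModuleCat.of (MoritaRing A B M N) Z.mod)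
      (ModuleCat.of (MoritaRing A B M N) Z'.mod) := by
  refine ⟨ModuleCat.of _ (ind A B M N P P').mod, φ.toLin, ψ.toLin, projective_ind hP hP',
    Hom.isShortExact_toLin.2 ⟨hα, hβ⟩, fun W _ _ hW θ => ?_⟩
  let e := ofModuleEquiv A B M N W
  have hW' : Module.Projective (MoritaRing A B M N) (ofModule A B M N W).mod :=
    Module.Projective.of_equiv e.symm
  -- W is a retract of an induced projective: extend the composite into the latter, then retract.
  obtain ⟨V, V', _, _, _, _, s, r, hV, hV', hrs, hrs'⟩ := exists_retract _ hW'
  obtain ⟨χ, hχ⟩ := exists_hom (s.toLin ∘ₗ e.symm.toLinearMap ∘ₗ θ)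
  obtain ⟨σ, h1, h2⟩ := hext V V' hV hV' χ
  refine ⟨e.toLinearMap ∘ₗ r.toLin ∘ₗ σ.toLin, ?_⟩
  ext z
  have h3 : σ.toLin (φ.toLin z) = χ.toLin z := pt_inj.2 ⟨h1 _, h2 _⟩
  have h4 : ∀ w, r.toLin (s.toLin w) = w := fun w => pt_inj.2 ⟨hrs _, hrs' _⟩
  change e (r.toLin (σ.toLin (φ.toLin z))) = θ z
  rw [h3, hχ]
  change e (r.toLin (s.toLin (e.symm (θ z)))) = θ z
  rw [h4, e.apply_symm_apply]

variable
  (hA : ∀ P : CochainComplex (ModuleCat.{u} A) ℤ, IsCompleteProjRes P →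
    TensExact N P ∧ HomAddExact P M)
  (hB : ∀ P : CochainComplex (ModuleCat.{u} B) ℤ, IsCompleteProjRes P →
    TensExact M P ∧ HomAddExact P N)

include hA hB

theorem IsCompatible.exists_cosyzygy {Z : Quad A B M N} (hZ : Z.IsCompatible) :
    ∃ Z' : Quad A B M N, Z'.IsCompatible ∧ ProjStep (ModuleCat.of (MoritaRing A B M N) Z.mod)
      (ModuleCat.of (MoritaRing A B M N) Z'.mod) := by
  obtain ⟨⟨GA, cX, hGA, ecX, scX⟩, ⟨GB, cY, hGB, ecY, scY⟩, hg, hf⟩ := hZ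
  obtain ⟨P, GA', iA, pA, hP, hGA', hsA⟩ := hGA.exists_cosyzygy
  obtain ⟨P', GB', iB, pB, hP', hGB', hsB⟩ := hGB.exists_cosyzygy
  have extA := fun (W : Type u) [AddCommGroup W] [Module A W] hW φ =>
    hGA'.exists_extension hsA (W := W) hW φ
  have extB := fun (W : Type u) [AddCommGroup W] [Module B W] hW φ =>
    hGB'.exists_extension hsB (W := W) hW φ
  -- The second coordinates of the embedding are forced on the images of g and f by compatibility
  -- with the structure maps. They extend because M ⊗ P' lies in Add M and N ⊗ P in Add N.
  obtain ⟨α, hα⟩ := exists_twist ecX scX ecY scY hg hGA (W := Tens B M P')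
    (fun C hC => (hA C hC).2 _ (inAdd_tens M hP')) (lTensₗ A M iB)
  obtain ⟨β, hβ⟩ := exists_twist (Z := Z.swap) ecY scY ecX scX hf hGB (W := Tens A N P)
    (fun C hC => (hB C hC).2 _ (inAdd_tens N hP)) (lTensₗ B N iA)
  let φ : Hom Z (ind A B M N P P') :=
    { α := (iA ∘ₗ cX).prod α
      β := (iB ∘ₗ cY).prod β
      hf := fun n x => by
        refine Prod.ext ?_ (hβ (tmul A n x))
        change iB (cY _) = 0
        rw [ecY.apply_apply_eq_zero, map_zero]
      hg := fun m y => by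
        refine Prod.ext ?_ (hα (tmul B m y))
        change iA (cX _) = 0
        rw [ecX.apply_apply_eq_zero, map_zero] }
  have iα : Function.Injective φ.α := embedding_injective ecX ecY scY hg hsA.inj
    (hGB'.lTens_injective hsB fun C hC => (hB C hC).1) hα
  have iβ : Function.Injective φ.β := embedding_injective (Z := Z.swap) ecY ecX scX hf hsB.inj
    (hGA'.lTens_injective hsA fun C hC => (hA C hC).1) hβ
  obtain ⟨Z', ψ, eα, sα, eβ, sβ⟩ := exists_cokernel φ
  have hφX : ∀ x, (φ.α x).1 = iA (cX x) := fun _ => rfl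
  have hφY : ∀ y, (φ.β y).1 = iB (cY y) := fun _ => rfl
  obtain ⟨cX', ecX', scX'⟩ := exists_coker_of_cosyzygy eα sα sβ scX hsA hφX
  obtain ⟨cY', ecY', scY'⟩ := exists_coker_of_cosyzygy (Z := Z.swap) (Z' := Z'.swap)
    (φ := φ.swap) (ψ := ψ.swap) eβ sβ sα scY hsB hφY
  refine ⟨Z', ⟨⟨GA', cX', hGA', ecX', scX'⟩, ⟨GB', cY', hGB', ecY', scY'⟩,
    exact_g_of_cosyzygy eα eβ sβ ecX hsA.inj hφX,
    exact_g_of_cosyzygy (Z := Z.swap) (Z' := Z'.swap)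
      (φ := φ.swap) (ψ := ψ.swap) eβ eα sα ecY hsB.inj hφY⟩,
    projStep_of_isShortExact hP hP' ⟨iα, eα, sα⟩ ⟨iβ, eβ, sβ⟩ ?_⟩
  intro V V' _ _ _ _ hV hV' χ
  exact exists_hom_extension ecX scX ecY scY
    (extA V fun C hC => hC.homExact V hV)
    (extA _ fun C hC => (hA C hC).2 _ (inAdd_tens M hV'))
    (extB V' fun C hC => hC.homExact V' hV')
    (extB _ fun C hC => (hB C hC).2 _ (inAdd_tens N hV)) hφX hφY χ

/-- Projective surjections onto the cokernels lift to X and Y and induce a surjection from an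
induced module. The cokernels of its kernel are the first syzygies of those of Z', and Tor₁
vanishing gives the exactness conditions. -/
theorem IsCompatible.exists_syzygy {Z' : Quad A B M N} (hZ' : Z'.IsCompatible) :
    ∃ Z : Quad A B M N, Z.IsCompatible ∧ ProjStep (ModuleCat.of (MoritaRing A B M N) Z.mod)
      (ModuleCat.of (MoritaRing A B M N) Z'.mod) := by
  obtain ⟨⟨GA, cX, hGA, ecX, scX⟩, ⟨GB, cY, hGB, ecY, scY⟩, hg, hf⟩ := hZ'
  obtain ⟨P, KA, jA, qA, hP, hKA, hsA, -, -⟩ := hGA.exists_syzygy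
  obtain ⟨P', KB, jB, qB, hP', hKB, hsB, -, -⟩ := hGB.exists_syzygy
  have extA := fun (W : Type u) [AddCommGroup W] [Module A W] hW φ =>
    hGA.exists_extension hsA (W := W) hW φ
  have extB := fun (W : Type u) [AddCommGroup W] [Module B W] hW φ =>
    hGB.exists_extension hsB (W := W) hW φ
  obtain ⟨γA, hγA⟩ := Module.projective_lifting_property cX qA scX
  obtain ⟨γB, hγB⟩ := Module.projective_lifting_property cY qB scY
  replace hγA : ∀ p, cX (γA p) = qA p := DFunLike.congr_fun hγA
  replace hγB : ∀ p, cY (γB p) = qB p := DFunLike.congr_fun hγB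
  let ψ : Hom (ind A B M N P P') Z' := indLift γA γB
  have sα : Function.Surjective ψ.α := cover_surjective ecX ecY scY hsA.surj hγA hsB.surj hγB
  have sβ : Function.Surjective ψ.β :=
    cover_surjective (Z' := Z'.swap) ecY ecX scX hsB.surj hγB hsA.surj hγA
  obtain ⟨Z, φ, eα, iα, eβ, iβ⟩ := exists_kernel ψ
  obtain ⟨c, sc, hc⟩ := exists_coker_of_syzygy eα ecX ecY scY hsA hγA hsB.surj hγB
  obtain ⟨d, sd, hd⟩ := exists_coker_of_syzygy (Z := Z.swap) (Z' := Z'.swap) (φ := φ.swap)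
    eβ ecY ecX scX hsB hγB hsA.surj hγA
  have ec : Function.Exact Z.g c :=
    exact_coker_of_syzygy eα iα hg ecY scY hsA.inj hsB hγB hc sd hd
  have ed : Function.Exact Z.f d := exact_coker_of_syzygy (Z := Z.swap) (Z' := Z'.swap)
    (φ := φ.swap) eβ iβ hf ecX scX hsB.inj hsA hγA hd sc hc
  refine ⟨Z, ⟨⟨KA, c, hKA, ec, sc⟩, ⟨KB, d, hKB, ed, sd⟩,
    exact_g_of_syzygy (hGB.lTens_injective hsB fun C hC => (hB C hC).1) sd ed hd,
    exact_g_of_syzygy (Z := Z.swap) (φ := φ.swap)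
      (hGA.lTens_injective hsA fun C hC => (hA C hC).1) sc ec hc⟩,
    projStep_of_isShortExact hP hP' ⟨iα, eα, sα⟩ ⟨iβ, eβ, sβ⟩ ?_⟩
  intro V V' _ _ _ _ hV hV' χ
  exact exists_hom_extension ec sc ed sd
    (extA V fun C hC => hC.homExact V hV)
    (extA _ fun C hC => (hA C hC).2 _ (inAdd_tens M hV'))
    (extB V' fun C hC => hC.homExact V' hV')
    (extB _ fun C hC => (hB C hC).2 _ (inAdd_tens N hV)) (fun x => (hc x).symm)
    (fun y => (hd y).symm) χ

theorem IsCompatible.isGorensteinProjective {Z : Quad A B M N} (hZ : Z.IsCompatible) :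
    IsGorensteinProjective (MoritaRing A B M N) Z.mod := by
  refine isGorensteinProjective_of_class
    (fun W => ∃ Z : Quad A B M N, Z.IsCompatible ∧ W = ModuleCat.of (MoritaRing A B M N) Z.mod)
    ?_ ?_ (ModuleCat.of (MoritaRing A B M N) Z.mod) ⟨Z, hZ, rfl⟩
  · rintro _ ⟨Z, hZ, rfl⟩
    obtain ⟨Z', hZ', h⟩ := hZ.exists_cosyzygy hA hB
    exact ⟨_, ⟨Z', hZ', rfl⟩, h⟩
  · rintro _ ⟨Z', hZ', rfl⟩
    obtain ⟨Z, hZ, h⟩ := hZ'.exists_syzygy hA hB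
    exact ⟨_, ⟨Z, hZ, rfl⟩, h⟩

end Quad

end Characterization

/-! ### From Gorenstein projective Λ-modules to their cokernels -/

section Cokernels

variable {A B M N : Type u} [Ring A] [Ring B]
  [AddCommGroup M] [Module A M] [Module Bᵐᵒᵖ M] [SMulCommClass A Bᵐᵒᵖ M]
  [AddCommGroup N] [Module B N] [Module Aᵐᵒᵖ N] [SMulCommClass B Aᵐᵒᵖ N]

namespace Quad

/-! ### The bimodule `A × B` -/

/-- The map `(A × B) ⊗_Λ Z → G`, `(a, b) ⊗ (x, y) ↦ a c(x)`, for a map `c : X → G` that vanishes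
on the image of `g`. -/
def diagTensX (Z : Quad A B M N) {G : Type u} [AddCommGroup G] [Module A G] (c : Z.X →ₗ[A] G)
    (hc : ∀ z, c (Z.g z) = 0) : Tens (MoritaRing A B M N) (Diag A B M N) Z.mod →+ G :=
  tensLift (MoritaRing A B M N)
    (AddMonoidHom.mk' (fun d => AddMonoidHom.mk' (fun z => (show A × B from d).1 • c z.1)
        (fun z w => by rw [← smul_add, ← map_add]; rfl))
      (fun d d' => by ext z; exact add_smul _ _ _))
    (fun d l z => by
      change ((show A × B from d).1 * l.a) • c z.1 =
        (show A × B from d).1 • c (l.a • z.1 + Z.g (tmul B l.m z.2))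
      rw [map_add, hc, add_zero, map_smul, mul_smul])

/-- The map `(A × B) ⊗_Λ Z → G`, `(a, b) ⊗ (x, y) ↦ b c(y)`, for a map `c : Y → G` that vanishes
on the image of `f`. -/
def diagTensY (Z : Quad A B M N) {G : Type u} [AddCommGroup G] [Module B G] (c : Z.Y →ₗ[B] G)
    (hc : ∀ z, c (Z.f z) = 0) : Tens (MoritaRing A B M N) (Diag A B M N) Z.mod →+ G :=
  tensLift (MoritaRing A B M N)
    (AddMonoidHom.mk' (fun d => AddMonoidHom.mk' (fun z => (show A × B from d).2 • c z.2)
        (fun z w => by rw [← smul_add, ← map_add]; rfl))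
      (fun d d' => by ext z; exact add_smul _ _ _))
    (fun d l z => by
      change ((show A × B from d).2 * l.b) • c z.2 =
        (show A × B from d).2 • c (Z.f (tmul A l.n z.1) + l.b • z.2)
      rw [map_add, hc, zero_add, map_smul, mul_smul])

variable {Z Q Z' : Quad A B M N}

/-- Injectivity on Coker g in disguise: (1, 0) ⊗ (x, 0) represents the class of x in Coker g. It
vanishes for x = g (m ⊗ y), because then (x, 0) is the matrix m applied to (0, y), and (1, 0) is
killed by m on the right. -/
theorem mem_range_g_of_injective {φ : Hom Z Q}
    (h : Function.Injective (lTens (MoritaRing A B M N) (Diag A B M N) φ.toLin))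
    {x : Z.X} {t : Tens B M Q.Y} (hx : Q.g t = φ.α x) : ∃ s, Z.g s = x := by
  let d : Diag A B M N := show Diag A B M N from ((1 : A), (0 : B))
  have h1 : ∀ t, tmul (MoritaRing A B M N) d (Q.pt (Q.g t) 0) = 0 := by
    intro t
    refine tens_induction B
      (p := fun t => tmul (MoritaRing A B M N) d (Q.pt (Q.g t) 0) = 0) ?_ ?_ ?_ t
    · rw [map_zero, pt_zero, tmul_zero]
    · intro m y
      have h2 : Q.pt (Q.g (tmul B m y)) 0 = (⟨0, m, 0, 0⟩ : MoritaRing A B M N) • Q.pt 0 y := by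
        simp [smul_pt, zero_tmul]
      have h3 : op (⟨0, m, 0, 0⟩ : MoritaRing A B M N) • d = 0 := by
        refine (diag_op_smul _ _).trans ?_
        simp only [mul_zero]
        rfl
      rw [h2, ← smul_tmul, h3, zero_tmul]
    · intro t t' ht ht'
      have h2 : Q.pt (Q.g (t + t')) 0 = Q.pt (Q.g t) 0 + Q.pt (Q.g t') 0 := by
        rw [pt_add, map_add, add_zero]
      rw [h2, tmul_add, ht, ht', add_zero]
  have h2 : tmul (MoritaRing A B M N) d (Z.pt x 0) = 0 := by
    refine h ?_
    rw [lTens_tmul, Hom.toLin_pt, map_zero, ← hx, h1, map_zero]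
  have hc := LinearMap.exact_map_mkQ_range Z.g
  -- The map to the cokernel of g detects the class of x.
  have h3 := congrArg (Z.diagTensX (LinearMap.range Z.g).mkQ hc.apply_apply_eq_zero) h2
  rw [map_zero] at h3
  exact (hc x).1 ((one_smul A _).symm.trans h3)

theorem mem_range_f_of_injective {φ : Hom Z Q}
    (h : Function.Injective (lTens (MoritaRing A B M N) (Diag A B M N) φ.toLin))
    {y : Z.Y} {t : Tens A N Q.X} (hy : Q.f t = φ.β y) : ∃ s, Z.f s = y := by
  let d : Diag A B M N := show Diag A B M N from ((0 : A), (1 : B))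
  have h1 : ∀ t, tmul (MoritaRing A B M N) d (Q.pt 0 (Q.f t)) = 0 := by
    intro t
    refine tens_induction A
      (p := fun t => tmul (MoritaRing A B M N) d (Q.pt 0 (Q.f t)) = 0) ?_ ?_ ?_ t
    · rw [map_zero, pt_zero, tmul_zero]
    · intro n x
      have h2 : Q.pt 0 (Q.f (tmul A n x)) = (⟨0, 0, n, 0⟩ : MoritaRing A B M N) • Q.pt x 0 := by
        simp [smul_pt, zero_tmul]
      have h3 : op (⟨0, 0, n, 0⟩ : MoritaRing A B M N) • d = 0 := by
        refine (diag_op_smul _ _).trans ?_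
        simp only [mul_zero]
        rfl
      rw [h2, ← smul_tmul, h3, zero_tmul]
    · intro t t' ht ht'
      have h2 : Q.pt 0 (Q.f (t + t')) = Q.pt 0 (Q.f t) + Q.pt 0 (Q.f t') := by
        rw [pt_add, map_add, add_zero]
      rw [h2, tmul_add, ht, ht', add_zero]
  have h2 : tmul (MoritaRing A B M N) d (Z.pt 0 y) = 0 := by
    refine h ?_
    rw [lTens_tmul, Hom.toLin_pt, map_zero, ← hy, h1, map_zero]
  have hc := LinearMap.exact_map_mkQ_range Z.f
  have h3 := congrArg (Z.diagTensY (LinearMap.range Z.f).mkQ hc.apply_apply_eq_zero) h2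
  rw [map_zero] at h3
  exact (hc y).1 ((one_smul B _).symm.trans h3)

variable (A B M N) in
/-- The quadruple `(W, 0, 0, 0)`. -/
abbrev inX (W : Type u) [AddCommGroup W] [Module A W] : Quad A B M N where
  X := W
  Y := PUnit
  f := 0
  g := 0
  hgf _ := rfl
  hfg _ := rfl

variable (A B M N) in
/-- The quadruple `(0, W, 0, 0)`. -/
abbrev inY (W : Type u) [AddCommGroup W] [Module B W] : Quad A B M N where
  X := PUnit
  Y := W
  f := 0
  g := 0
  hgf _ := rfl
  hfg _ := rfl

/-- W is a summand of a free A-module, and (A, 0, 0, 0) is a summand of A × B; the coefficients of a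
splitting are placed in the first factor. -/
theorem inAdd_inX (W : Type u) [AddCommGroup W] [Module A W] (hW : Module.Projective A W) :
    InAdd (MoritaRing A B M N) (Diag A B M N) (inX A B M N W).mod := by
  obtain ⟨σ, hσ⟩ := Module.projective_def'.1 hW
  let ε : A →+ Diag A B M N := AddMonoidHom.inl A B
  have hε : ∀ (l : MoritaRing A B M N) a, l • ε a = ε (l.a * a) := fun l a =>
    (diag_smul l (a, 0)).trans (by simp only [mul_zero]; rfl)
  let s : (inX A B M N W).mod →ₗ[MoritaRing A B M N] (W →₀ Diag A B M N) :=
    { toFun := fun z => (σ z.1).mapRange ε (map_zero ε)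
      map_add' := fun z w => by
        rw [← Finsupp.mapRange_add (map_add ε), ← map_add]; rfl
      map_smul' := fun l z => by
        ext j
        change ε (σ (l.a • z.1 + 0) j) = l • ε (σ z.1 j)
        rw [add_zero, map_smul, hε]
        rfl }
  let r : (W →₀ Diag A B M N) →ₗ[MoritaRing A B M N] (inX A B M N W).mod :=
    Finsupp.lsum ℕ fun w =>
      { toFun := fun d => (inX A B M N W).pt ((show A × B from d).1 • w) 0
        map_add' := fun d d' => by
          rw [pt_add, ← add_smul]; rfl
        map_smul' := fun l d => by
          change (inX A B M N W).pt ((l.a * (show A × B from d).1) • w) 0 =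
            l • (inX A B M N W).pt ((show A × B from d).1 • w) 0
          rw [smul_pt, mul_smul]
          simp }
  refine ⟨W, s, r, ?_⟩
  have key : ∀ v : W →₀ A, r (v.mapRange ε (map_zero ε)) =
      (inX A B M N W).pt (Finsupp.linearCombination A id v) 0 := by
    intro v
    induction v using Finsupp.induction_linear with
    | zero => simp [pt_zero]
    | add a b ha hb =>
      rw [Finsupp.mapRange_add (map_add ε), map_add, ha, hb, map_add, pt_add]
    | single w a =>
      rw [Finsupp.mapRange_single, Finsupp.linearCombination_single]
      exact Finsupp.sum_single_index (Prod.ext (zero_smul A w) rfl)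
  ext z
  exact (key (σ z.1)).trans (pt_inj.2 ⟨DFunLike.congr_fun hσ z.1, rfl⟩)

theorem inAdd_inY (W : Type u) [AddCommGroup W] [Module B W] (hW : Module.Projective B W) :
    InAdd (MoritaRing A B M N) (Diag A B M N) (inY A B M N W).mod := by
  obtain ⟨σ, hσ⟩ := Module.projective_def'.1 hW
  let ε : B →+ Diag A B M N := AddMonoidHom.inr A B
  have hε : ∀ (l : MoritaRing A B M N) b, l • ε b = ε (l.b * b) := fun l b =>
    (diag_smul l (0, b)).trans (by simp only [mul_zero]; rfl)
  let s : (inY A B M N W).mod →ₗ[MoritaRing A B M N] (W →₀ Diag A B M N) :=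
    { toFun := fun z => (σ z.2).mapRange ε (map_zero ε)
      map_add' := fun z w => by
        rw [← Finsupp.mapRange_add (map_add ε), ← map_add]; rfl
      map_smul' := fun l z => by
        ext j
        change ε (σ (0 + l.b • z.2) j) = l • ε (σ z.2 j)
        rw [zero_add, map_smul, hε]
        rfl }
  let r : (W →₀ Diag A B M N) →ₗ[MoritaRing A B M N] (inY A B M N W).mod :=
    Finsupp.lsum ℕ fun w =>
      { toFun := fun d => (inY A B M N W).pt PUnit.unit ((show A × B from d).2 • w : W)
        map_add' := fun d d' => by
          rw [pt_add, ← add_smul (R := B) (M := W)]; rfl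
        map_smul' := fun l d => by
          change (inY A B M N W).pt 0 ((l.b * (show A × B from d).2) • w : W) =
            l • (inY A B M N W).pt 0 ((show A × B from d).2 • w : W)
          rw [smul_pt, mul_smul]
          simp }
  refine ⟨W, s, r, ?_⟩
  have key : ∀ v : W →₀ B, r (v.mapRange ε (map_zero ε)) =
      (inY A B M N W).pt 0 (Finsupp.linearCombination B id v) := by
    intro v
    induction v using Finsupp.induction_linear with
    | zero => simp [pt_zero]
    | add a b ha hb =>
      rw [Finsupp.mapRange_add (map_add ε), map_add, ha, hb, map_add, pt_add]
    | single w b =>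
      rw [Finsupp.mapRange_single, Finsupp.linearCombination_single]
      exact Finsupp.sum_single_index (Prod.ext rfl (zero_smul B w))
  ext z
  exact (key (σ z.2)).trans (pt_inj.2 ⟨rfl, DFunLike.congr_fun hσ z.2⟩)

/-! ### Cokernels in short exact sequences of quadruples -/

/-- For an induced module the cokernel of g is V, and cokernels preserve retracts, so G is a summand
of V. -/
theorem projective_coker_of_retract {V V' : Type u} [AddCommGroup V] [Module A V]
    [AddCommGroup V'] [Module B V'] (hV : Module.Projective A V)
    {s : Hom Z (ind A B M N V V')} {r : Hom (ind A B M N V V') Z} (hrs : ∀ x, r.α (s.α x) = x)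
    {G : Type u} [AddCommGroup G] [Module A G] {c : Z.X →ₗ[A] G} (ec : Function.Exact Z.g c)
    (sc : Function.Surjective c) : Module.Projective A G := by
  obtain ⟨σ, hσ⟩ := exists_desc ec sc (LinearMap.fst A V (Tens B M V') ∘ₗ s.α) (fun z => by
    rw [LinearMap.comp_apply, s.map_g, ind_g]; rfl)
  refine Module.Projective.of_split σ (c ∘ₗ r.α ∘ₗ LinearMap.inl A V (Tens B M V')) ?_
  ext y
  obtain ⟨x, rfl⟩ := sc y
  obtain ⟨t, ht⟩ := lTens_surjective M
    (LinearMap.fst_surjective (R := B) (M := V') (M₂ := Tens A N V)) (s.α x).2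
  change c (r.α (σ (c x), 0)) = c x
  have h1 : (((s.α x).1, 0) : V × Tens B M V') = s.α x - (ind A B M N V V').g t := by
    rw [ind_g, ht]
    refine Prod.ext ?_ ?_
    · exact (sub_zero _).symm
    · exact (sub_self _).symm
  rw [hσ]
  change c (r.α ((s.α x).1, 0)) = c x
  rw [h1, map_sub, map_sub, hrs, r.map_g, ec.apply_apply_eq_zero, sub_zero]

/-- Passing to cokernels of g is right exact; `hmem` supplies exactly the missing injectivity on the
left. -/
theorem isShortExact_coker {φ : Hom Z Q} {ψ : Hom Q Z'} (hα : IsShortExact φ.α ψ.α)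
    (sβ : Function.Surjective ψ.β) (hmem : ∀ x t, Q.g t = φ.α x → ∃ s, Z.g s = x)
    {G P G' : Type u} [AddCommGroup G] [Module A G] [AddCommGroup P] [Module A P]
    [AddCommGroup G'] [Module A G'] {c : Z.X →ₗ[A] G} (ec : Function.Exact Z.g c)
    (sc : Function.Surjective c) {b : Q.X →ₗ[A] P} (eb : Function.Exact Q.g b)
    (sb : Function.Surjective b) {c' : Z'.X →ₗ[A] G'} (ec' : Function.Exact Z'.g c')
    (sc' : Function.Surjective c') :
    ∃ (i : G →ₗ[A] P) (p : P →ₗ[A] G'), IsShortExact i p ∧ ∀ x, i (c x) = b (φ.α x) := by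
  obtain ⟨i, hi⟩ := exists_desc ec sc (b ∘ₗ φ.α) (fun z => by
    rw [LinearMap.comp_apply, φ.map_g, eb.apply_apply_eq_zero])
  obtain ⟨p, hp⟩ := exists_desc eb sb (c' ∘ₗ ψ.α) (fun z => by
    rw [LinearMap.comp_apply, ψ.map_g, ec'.apply_apply_eq_zero])
  refine ⟨i, p, ⟨?_, fun w => ⟨fun hw => ?_, ?_⟩, ?_⟩, hi⟩
  · rw [injective_iff_map_eq_zero]
    intro y hy
    obtain ⟨x, rfl⟩ := sc y
    rw [hi] at hy
    obtain ⟨t, ht⟩ := (eb _).1 hy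
    exact (ec x).2 (hmem x t ht)
  · obtain ⟨q, rfl⟩ := sb w
    rw [hp] at hw
    obtain ⟨t', ht'⟩ := (ec' _).1 hw
    obtain ⟨t, rfl⟩ := lTens_surjective M sβ t'
    obtain ⟨x, hx⟩ := (hα.exact (q - Q.g t)).1 (by rw [map_sub, ψ.map_g, ht', sub_self])
    exact ⟨c x, by rw [hi, LinearMap.comp_apply, hx, map_sub, eb.apply_apply_eq_zero, sub_zero]⟩
  · rintro ⟨y, rfl⟩
    obtain ⟨x, rfl⟩ := sc y
    rw [hi, LinearMap.comp_apply, hp, LinearMap.comp_apply, hα.exact.apply_apply_eq_zero, map_zero]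
  · intro y
    obtain ⟨x', rfl⟩ := sc' y
    obtain ⟨q, rfl⟩ := hα.surj x'
    exact ⟨b q, hp q⟩

theorem projStep_coker {φ : Hom Z Q} {ψ : Hom Q Z'} (hα : IsShortExact φ.α ψ.α)
    (sβ : Function.Surjective ψ.β) (hmem : ∀ x t, Q.g t = φ.α x → ∃ s, Z.g s = x)
    (hext : ∀ (W : Type u) [AddCommGroup W] [Module A W], Module.Projective A W →
      ∀ χ : Z.X →ₗ[A] W, (∀ z, χ (Z.g z) = 0) →
        ∃ σ : Q.X →ₗ[A] W, (∀ z, σ (Q.g z) = 0) ∧ ∀ x, σ (φ.α x) = χ x)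
    {G G' : ModuleCat.{u} A} {P : Type u} [AddCommGroup P] [Module A P]
    (hP : Module.Projective A P) {c : Z.X →ₗ[A] G} (ec : Function.Exact Z.g c)
    (sc : Function.Surjective c) {b : Q.X →ₗ[A] P} (eb : Function.Exact Q.g b)
    (sb : Function.Surjective b) {c' : Z'.X →ₗ[A] G'} (ec' : Function.Exact Z'.g c')
    (sc' : Function.Surjective c') : ProjStep G G' := by
  obtain ⟨i, p, hip, hi⟩ := isShortExact_coker hα sβ hmem ec sc eb sb ec' sc'
  refine ⟨ModuleCat.of A P, i, p, hP, hip, fun W _ _ hW χ => ?_⟩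
  obtain ⟨σ, h1, h2⟩ := hext W hW (χ ∘ₗ c) (fun z => by
    rw [LinearMap.comp_apply, ec.apply_apply_eq_zero, map_zero])
  obtain ⟨τ, hτ⟩ := exists_desc eb sb σ h1
  refine ⟨τ, ?_⟩
  ext y
  obtain ⟨x, rfl⟩ := sc y
  change τ (i (c x)) = χ (c x)
  rw [hi, hτ, h2]
  rfl

/-- Tor₁(M, G') = 0 makes M ⊗ Coker f of Z embed in that of Q. If g t = 0, exactness for Q shows
that t dies in the latter, hence in the former, so t comes from `1 ⊗ f`. -/
theorem exact_g_of_coker {φ : Hom Z Q} {ψ : Hom Q Z'} (hβ : IsShortExact φ.β ψ.β)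
    (sα : Function.Surjective ψ.α) (hmem : ∀ y t, Q.f t = φ.β y → ∃ s, Z.f s = y)
    (hQ : Function.Exact (lTens B M Q.f) Q.g)
    {G' : Type u} [AddCommGroup G'] [Module B G'] {c' : Z'.Y →ₗ[B] G'}
    (ec' : Function.Exact Z'.f c') (sc' : Function.Surjective c')
    (hG' : IsGorensteinProjective B G')
    (hM : ∀ C : CochainComplex (ModuleCat.{u} B) ℤ, IsCompleteProjRes C → TensExact M C) :
    Function.Exact (lTens B M Z.f) Z.g := by
  have ec := LinearMap.exact_map_mkQ_range Z.f
  have eb := LinearMap.exact_map_mkQ_range Q.f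
  have sc := Submodule.mkQ_surjective (LinearMap.range Z.f)
  have sb := Submodule.mkQ_surjective (LinearMap.range Q.f)
  obtain ⟨i, p, hip, hi⟩ := isShortExact_coker (Z := Z.swap) (Q := Q.swap) (Z' := Z'.swap)
    (φ := φ.swap) (ψ := ψ.swap) hβ sα hmem ec sc eb sb ec' sc'
  intro t
  constructor
  · intro ht
    obtain ⟨w, hw⟩ := (hQ (lTens B M φ.β t)).1 (by rw [← φ.map_g, ht, map_zero])
    have h1 : i ∘ₗ (LinearMap.range Z.f).mkQ = (LinearMap.range Q.f).mkQ ∘ₗ φ.β :=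
      LinearMap.ext hi
    refine (lTens_exact M ec sc t).1 (hG'.lTens_injective hip hM ?_)
    rw [← lTens_comp, h1, lTens_comp, ← hw, ← lTens_comp, eb.linearMap_comp_eq_zero, lTens_zero,
      map_zero]
  · rintro ⟨w, rfl⟩
    exact Z.hgf w

/-- There is a short exact sequence `0 → Z → Q → Z' → 0` with `Q` projective that stays exact
under `(A × B) ⊗_Λ -` and under `Hom(-, W)` for `W` in `Add (A × B)`. -/
def DiagStep (Z Z' : Quad A B M N) : Prop :=
  ∃ (Q : Quad A B M N) (φ : Hom Z Q) (ψ : Hom Q Z'), IsShortExact φ.α ψ.α ∧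
    IsShortExact φ.β ψ.β ∧ Module.Projective (MoritaRing A B M N) Q.mod ∧
    Function.Injective (lTens (MoritaRing A B M N) (Diag A B M N) φ.toLin) ∧
    ∀ (W : Type u) [AddCommGroup W] [Module (MoritaRing A B M N) W],
      InAdd (MoritaRing A B M N) (Diag A B M N) W →
      ∀ χ : Z.mod →ₗ[MoritaRing A B M N] W, ∃ σ : Q.mod →ₗ[MoritaRing A B M N] W,
        σ ∘ₗ φ.toLin = χ

/-- Injectivity after tensoring with A × B gives a short exact sequence of cokernels. A map Coker g
→ W is the same as a Λ-map to (W, 0, 0, 0), which lies in Add (A × B) for projective W and therefore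
extends. -/
theorem DiagStep.projStep_cokerX (h : DiagStep Z Z') {G G' : ModuleCat.{u} A}
    {c : Z.X →ₗ[A] G} (ec : Function.Exact Z.g c) (sc : Function.Surjective c)
    {c' : Z'.X →ₗ[A] G'} (ec' : Function.Exact Z'.g c') (sc' : Function.Surjective c') :
    ProjStep G G' := by
  obtain ⟨Q, φ, ψ, hα, hβ, hQ, hT, hW⟩ := h
  obtain ⟨V, V', _, _, _, _, s, r, hV, -, hrs, -⟩ := exists_retract Q hQ
  have eb := LinearMap.exact_map_mkQ_range Q.g
  have sb := Submodule.mkQ_surjective (LinearMap.range Q.g)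
  refine projStep_coker hα hβ.surj (fun x t => mem_range_g_of_injective hT) ?_
    (projective_coker_of_retract hV hrs eb sb) ec sc eb sb ec' sc'
  intro W _ _ hWp χ hχ
  let θ : Hom Z (inX A B M N W) := ⟨χ, 0, fun _ _ => rfl, fun m y => hχ _⟩
  obtain ⟨τ, hτ⟩ := hW _ (inAdd_inX W hWp) θ.toLin
  obtain ⟨σ, rfl⟩ := exists_hom τ
  exact ⟨σ.α, fun z => σ.map_g z, fun x =>
    (pt_inj.1 (DFunLike.congr_fun hτ (Z.pt x 0))).1⟩

theorem DiagStep.projStep_cokerY (h : DiagStep Z Z') {G G' : ModuleCat.{u} B}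
    {c : Z.Y →ₗ[B] G} (ec : Function.Exact Z.f c) (sc : Function.Surjective c)
    {c' : Z'.Y →ₗ[B] G'} (ec' : Function.Exact Z'.f c') (sc' : Function.Surjective c') :
    ProjStep G G' := by
  obtain ⟨Q, φ, ψ, hα, hβ, hQ, hT, hW⟩ := h
  obtain ⟨V, V', _, _, _, _, s, r, -, hV', -, hrs⟩ := exists_retract Q hQ
  have eb := LinearMap.exact_map_mkQ_range Q.f
  have sb := Submodule.mkQ_surjective (LinearMap.range Q.f)
  refine projStep_coker (Z := Z.swap) (Q := Q.swap) (Z' := Z'.swap) (φ := φ.swap) (ψ := ψ.swap)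
    hβ hα.surj (fun x t => mem_range_f_of_injective hT) ?_
    (projective_coker_of_retract (Z := Q.swap) (s := s.swap) (r := r.swap) hV' hrs eb sb)
    ec sc eb sb ec' sc'
  intro W _ _ hWp χ hχ
  let θ : Hom Z (inY A B M N W) := ⟨0, χ, fun n x => hχ _, fun _ _ => rfl⟩
  obtain ⟨τ, hτ⟩ := hW _ (inAdd_inY W hWp) θ.toLin
  obtain ⟨σ, rfl⟩ := exists_hom τ
  exact ⟨σ.β, fun z => σ.map_f z, fun y =>
    (pt_inj.1 (DFunLike.congr_fun hτ (Z.pt 0 y))).2⟩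

/-- The sequence is transported to quadruples; the tensor and Hom clauses are vanishing of Tor₁ and
Ext¹ on its Gorenstein projective end. -/
theorem diagStep_of_isShortExact
    (hΛ : ∀ Q : CochainComplex (ModuleCat.{u} (MoritaRing A B M N)) ℤ, IsCompleteProjRes Q →
      TensExact (Diag A B M N) Q ∧ HomAddExact Q (Diag A B M N))
    {K P G : Type u} [AddCommGroup K] [Module (MoritaRing A B M N) K] [AddCommGroup P]
    [Module (MoritaRing A B M N) P] [AddCommGroup G] [Module (MoritaRing A B M N) G]
    (hP : Module.Projective (MoritaRing A B M N) P)
    (hG : IsGorensteinProjective (MoritaRing A B M N) G)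
    {i : K →ₗ[MoritaRing A B M N] P} {p : P →ₗ[MoritaRing A B M N] G} (h : IsShortExact i p)
    (e : Z.mod ≃ₗ[MoritaRing A B M N] K) (e' : Z'.mod ≃ₗ[MoritaRing A B M N] G) :
    DiagStep Z Z' := by
  let d := ofModuleEquiv A B M N P
  obtain ⟨φ, hφ⟩ := exists_hom (d.symm.toLinearMap ∘ₗ i ∘ₗ e.toLinearMap)
  obtain ⟨ψ, hψ⟩ := exists_hom (e'.symm.toLinearMap ∘ₗ p ∘ₗ d.toLinearMap)
  have hs : IsShortExact φ.toLin ψ.toLin := by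
    rw [hφ, hψ]
    refine ⟨d.symm.injective.comp (h.inj.comp e.injective), fun x => ?_,
      e'.symm.surjective.comp (h.surj.comp d.surjective)⟩
    change e'.symm (p (d x)) = 0 ↔ ∃ y, d.symm (i (e y)) = x
    rw [e'.symm.map_eq_zero_iff, h.exact]
    constructor
    · rintro ⟨k, hk⟩
      exact ⟨e.symm k, by rw [e.apply_symm_apply, hk, d.symm_apply_apply]⟩
    · rintro ⟨y, rfl⟩
      exact ⟨e y, (d.apply_symm_apply _).symm⟩
  have hG' : IsGorensteinProjective (MoritaRing A B M N) Z'.mod := hG.of_equiv e'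
  obtain ⟨hα, hβ⟩ := Hom.isShortExact_toLin.1 hs
  exact ⟨_, φ, ψ, hα, hβ, Module.Projective.of_equiv d.symm,
    hG'.lTens_injective hs fun C hC => (hΛ C hC).1,
    fun W _ _ hW χ => hG'.exists_extension hs (fun C hC => (hΛ C hC).2 W hW) χ⟩

variable
  (hΛ : ∀ Q : CochainComplex (ModuleCat.{u} (MoritaRing A B M N)) ℤ, IsCompleteProjRes Q →
    TensExact (Diag A B M N) Q ∧ HomAddExact Q (Diag A B M N))

include hΛ

theorem exists_diagStep_right (hZ : IsGorensteinProjective (MoritaRing A B M N) Z.mod) :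
    ∃ Z' : Quad A B M N, IsGorensteinProjective (MoritaRing A B M N) Z'.mod ∧ DiagStep Z Z' := by
  obtain ⟨P, G, i, p, hP, hG, h⟩ := hZ.exists_cosyzygy
  let e := ofModuleEquiv A B M N G
  exact ⟨_, hG.of_equiv e, diagStep_of_isShortExact hΛ hP hG h (LinearEquiv.refl _ _) e⟩

theorem exists_diagStep_left (hZ : IsGorensteinProjective (MoritaRing A B M N) Z'.mod) :
    ∃ Z : Quad A B M N, IsGorensteinProjective (MoritaRing A B M N) Z.mod ∧ DiagStep Z Z' := by
  obtain ⟨P, K, i, p, hP, hK, h, -, -⟩ := hZ.exists_syzygy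
  let e := ofModuleEquiv A B M N K
  exact ⟨_, hK.of_equiv e, diagStep_of_isShortExact hΛ hP hZ h e (LinearEquiv.refl _ _)⟩

/-- The class of cokernels of g over Gorenstein projective Λ-modules is closed under syzygies and
cosyzygies, because a Λ-step in either direction induces a step of cokernels. -/
theorem isGorensteinProjective_cokerX
    (hZ : IsGorensteinProjective (MoritaRing A B M N) Z.mod) :
    IsGorensteinProjective A (Z.X ⧸ LinearMap.range Z.g) := by
  refine isGorensteinProjective_of_class
    (fun G => ∃ (Z : Quad A B M N) (c : Z.X →ₗ[A] G),
      IsGorensteinProjective (MoritaRing A B M N) Z.mod ∧ Function.Exact Z.g c ∧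
        Function.Surjective c) ?_ ?_ (ModuleCat.of A (Z.X ⧸ LinearMap.range Z.g))
    ⟨Z, (LinearMap.range Z.g).mkQ, hZ, LinearMap.exact_map_mkQ_range _,
      Submodule.mkQ_surjective _⟩
  · rintro G ⟨Z, c, hZ, ec, sc⟩
    obtain ⟨Z', hZ', h⟩ := exists_diagStep_right hΛ hZ
    exact ⟨ModuleCat.of A (Z'.X ⧸ LinearMap.range Z'.g), ⟨Z', (LinearMap.range Z'.g).mkQ, hZ',
      LinearMap.exact_map_mkQ_range _, Submodule.mkQ_surjective _⟩,
      h.projStep_cokerX ec sc (LinearMap.exact_map_mkQ_range _) (Submodule.mkQ_surjective _)⟩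
  · rintro G ⟨Z', c, hZ', ec, sc⟩
    obtain ⟨Z, hZ, h⟩ := exists_diagStep_left hΛ hZ'
    exact ⟨ModuleCat.of A (Z.X ⧸ LinearMap.range Z.g), ⟨Z, (LinearMap.range Z.g).mkQ, hZ,
      LinearMap.exact_map_mkQ_range _, Submodule.mkQ_surjective _⟩,
      h.projStep_cokerX (LinearMap.exact_map_mkQ_range _) (Submodule.mkQ_surjective _) ec sc⟩

theorem isGorensteinProjective_cokerY
    (hZ : IsGorensteinProjective (MoritaRing A B M N) Z.mod) :
    IsGorensteinProjective B (Z.Y ⧸ LinearMap.range Z.f) := by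
  refine isGorensteinProjective_of_class
    (fun G => ∃ (Z : Quad A B M N) (c : Z.Y →ₗ[B] G),
      IsGorensteinProjective (MoritaRing A B M N) Z.mod ∧ Function.Exact Z.f c ∧
        Function.Surjective c) ?_ ?_ (ModuleCat.of B (Z.Y ⧸ LinearMap.range Z.f))
    ⟨Z, (LinearMap.range Z.f).mkQ, hZ, LinearMap.exact_map_mkQ_range _,
      Submodule.mkQ_surjective _⟩
  · rintro G ⟨Z, c, hZ, ec, sc⟩
    obtain ⟨Z', hZ', h⟩ := exists_diagStep_right hΛ hZ
    exact ⟨ModuleCat.of B (Z'.Y ⧸ LinearMap.range Z'.f), ⟨Z', (LinearMap.range Z'.f).mkQ, hZ',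
      LinearMap.exact_map_mkQ_range _, Submodule.mkQ_surjective _⟩,
      h.projStep_cokerY ec sc (LinearMap.exact_map_mkQ_range _) (Submodule.mkQ_surjective _)⟩
  · rintro G ⟨Z', c, hZ', ec, sc⟩
    obtain ⟨Z, hZ, h⟩ := exists_diagStep_left hΛ hZ'
    exact ⟨ModuleCat.of B (Z.Y ⧸ LinearMap.range Z.f), ⟨Z, (LinearMap.range Z.f).mkQ, hZ,
      LinearMap.exact_map_mkQ_range _, Submodule.mkQ_surjective _⟩,
      h.projStep_cokerY (LinearMap.exact_map_mkQ_range _) (Submodule.mkQ_surjective _) ec sc⟩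

theorem isCompatible_of_isGorensteinProjective
    (hN : ∀ P : CochainComplex (ModuleCat.{u} A) ℤ, IsCompleteProjRes P → TensExact N P)
    (hM : ∀ P : CochainComplex (ModuleCat.{u} B) ℤ, IsCompleteProjRes P → TensExact M P)
    (hZ : IsGorensteinProjective (MoritaRing A B M N) Z.mod) : Z.IsCompatible := by
  obtain ⟨Z', hZ', Q, φ, ψ, hα, hβ, hQ, hT, -⟩ := exists_diagStep_right hΛ hZ
  exact ⟨⟨ModuleCat.of A (Z.X ⧸ LinearMap.range Z.g), (LinearMap.range Z.g).mkQ,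
      isGorensteinProjective_cokerX hΛ hZ, LinearMap.exact_map_mkQ_range _,
      Submodule.mkQ_surjective _⟩,
    ⟨ModuleCat.of B (Z.Y ⧸ LinearMap.range Z.f), (LinearMap.range Z.f).mkQ,
      isGorensteinProjective_cokerY hΛ hZ, LinearMap.exact_map_mkQ_range _,
      Submodule.mkQ_surjective _⟩,
    exact_g_of_coker hβ hα.surj (fun y t => mem_range_f_of_injective hT)
      (exact_g_of_projective Q hQ) (LinearMap.exact_map_mkQ_range _) (Submodule.mkQ_surjective _)
      (isGorensteinProjective_cokerY hΛ hZ') hM,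
    exact_g_of_coker (Z := Z.swap) (Q := Q.swap) (Z' := Z'.swap) (φ := φ.swap) (ψ := ψ.swap)
      hα hβ.surj (fun y t => mem_range_g_of_injective hT)
      (exact_f_of_projective Q hQ) (LinearMap.exact_map_mkQ_range _) (Submodule.mkQ_surjective _)
      (isGorensteinProjective_cokerX hΛ hZ') hN⟩

end Quad

/-- `M ⊗ Y' → M ⊗ Y → X` is exact if and only if `g` induces an isomorphism from
`M ⊗ Coker f` onto its image. -/
theorem exact_iff_exists_equiv {F X Y : Type u} [AddCommGroup F] [Module B F] [AddCommGroup X]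
    [Module A X] [AddCommGroup Y] [Module B Y] (f : F →ₗ[B] Y) (g : Tens B M Y →ₗ[A] X)
    (hgf : ∀ z, g (lTens B M f z) = 0) :
    Function.Exact (lTens B M f) g ↔
      ∃ e : Tens B M (Y ⧸ LinearMap.range f) ≃ₗ[A] LinearMap.range g,
        ∀ (m : M) (y : Y), (e (tmul B m (Submodule.Quotient.mk y)) : X) = g (tmul B m y) := by
  have ec := LinearMap.exact_map_mkQ_range f
  have sc := Submodule.mkQ_surjective (LinearMap.range f)
  constructor
  · intro h
    obtain ⟨γ, hγ⟩ := exists_tens_desc M ec sc g.rangeRestrict (fun z => Subtype.ext (hgf z))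
    refine ⟨LinearEquiv.ofBijective γ ⟨?_, fun x => ?_⟩, fun m y =>
      congrArg Subtype.val (hγ (tmul B m y))⟩
    · rw [injective_iff_map_eq_zero]
      intro z hz
      obtain ⟨w, rfl⟩ := lTens_surjective M sc z
      rw [hγ] at hz
      exact (lTens_exact M ec sc w).2 ((h w).1 (congrArg Subtype.val hz))
    · obtain ⟨w, rfl⟩ := g.surjective_rangeRestrict x
      exact ⟨_, hγ w⟩
  · rintro ⟨e, he⟩ z
    -- The formula on elementary tensors says that g is M ⊗ Y → M ⊗ Coker f followed by an
    -- injection, so both have the same kernel.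
    have h1 : (LinearMap.range g).subtype ∘ₗ e.toLinearMap ∘ₗ
        lTensₗ A M (LinearMap.range f).mkQ = g := tens_hom_ext' M he
    constructor
    · intro hz
      rw [← h1] at hz
      refine (lTens_exact M ec sc z).1 (e.injective (Subtype.ext ?_))
      rw [map_zero]
      exact hz
    · rintro ⟨w, rfl⟩
      exact hgf w

end Cokernels

end MoritaGP

theorem corollary4p3 {A B M N : Type u} [Ring A] [Ring B]
    [AddCommGroup M] [Module A M] [Module Bᵐᵒᵖ M] [SMulCommClass A Bᵐᵒᵖ M]
    [AddCommGroup N] [Module B N] [Module Aᵐᵒᵖ N] [SMulCommClass B Aᵐᵒᵖ N]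
    (hA : ∀ P : CochainComplex (ModuleCat.{u} A) ℤ, IsCompleteProjRes P →
      TensExact N P ∧ HomAddExact P M)
    (hB : ∀ P : CochainComplex (ModuleCat.{u} B) ℤ, IsCompleteProjRes P →
      TensExact M P ∧ HomAddExact P N)
    (hΛ : ∀ Q : CochainComplex (ModuleCat.{u} (MoritaRing A B M N)) ℤ, IsCompleteProjRes Q →
      TensExact (Diag A B M N) Q ∧ HomAddExact Q (Diag A B M N))
    {X Y : Type u} [AddCommGroup X] [Module A X] [AddCommGroup Y] [Module B Y]
    (f : Tens A N X →ₗ[B] Y) (g : Tens B M Y →ₗ[A] X)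
    (hgf : ∀ z, g (lTens B M f z) = 0) (hfg : ∀ z, f (lTens A N g z) = 0) :
    List.TFAE [
      IsGorensteinProjective (MoritaRing A B M N) (QuadMod f g hgf hfg),
      IsGorensteinProjective B (Y ⧸ LinearMap.range f) ∧
        IsGorensteinProjective A (X ⧸ LinearMap.range g) ∧
        (∃ e : Tens B M (Y ⧸ LinearMap.range f) ≃ₗ[A] LinearMap.range g,
          ∀ (m : M) (y : Y), (e (tmul B m (Submodule.Quotient.mk y)) : X) = g (tmul B m y)) ∧
        (∃ e : Tens A N (X ⧸ LinearMap.range g) ≃ₗ[B] LinearMap.range f,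
          ∀ (n : N) (x : X), (e (tmul A n (Submodule.Quotient.mk x)) : Y) = f (tmul A n x)),
      IsGorensteinProjective B (Y ⧸ LinearMap.range f) ∧
        IsGorensteinProjective A (X ⧸ LinearMap.range g) ∧
        Function.Exact (lTens B M f) g ∧
        Function.Exact (lTens A N g) f] := by
  let Z : Quad A B M N := ⟨X, Y, f, g, hgf, hfg⟩
  tfae_have 1 → 3 := fun h =>
    have hZ : Z.IsCompatible := Quad.isCompatible_of_isGorensteinProjective hΛ
      (fun P hP => (hA P hP).1) (fun P hP => (hB P hP).1) h
    ⟨Quad.isGorensteinProjective_cokerY (Z := Z) hΛ h,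
      Quad.isGorensteinProjective_cokerX (Z := Z) hΛ h, hZ.exact_g, hZ.exact_f⟩
  tfae_have 3 → 1 := by
    rintro ⟨h1, h2, h3, h4⟩
    have hZ : Z.IsCompatible :=
      ⟨⟨ModuleCat.of A (X ⧸ LinearMap.range g), (LinearMap.range g).mkQ, h2,
          LinearMap.exact_map_mkQ_range _, Submodule.mkQ_surjective _⟩,
        ⟨ModuleCat.of B (Y ⧸ LinearMap.range f), (LinearMap.range f).mkQ, h1,
          LinearMap.exact_map_mkQ_range _, Submodule.mkQ_surjective _⟩, h3, h4⟩
    exact hZ.isGorensteinProjective hA hB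
  tfae_have 2 ↔ 3 := by
    rw [exact_iff_exists_equiv f g hgf, exact_iff_exists_equiv g f hfg]
  tfae_finish
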